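/- Let $m>0$, $F=1-2mR$, and consider the exterior of the Schwarzschild black hole of mass $m$ with coordinates $u=t-r_*$, $R=1/r$, $\omega\in S^2$, where $r_*=r+2m\log(r-2m)$, with the rescaled metric $\hat g=R^2F\,du^2-2\,du\,dR-d\omega^2$ extended to future null infinity $\{R=0\}$. For $u_0<0$ put $\Omega^+_{u_0}=\{u\le u_0,\ 0\le t\le+\infty\}$ (the points with $t=+\infty$ being those with $R=0$), $\mathcal H_s=\{u=-sr_*,\ u\le u_0\}$ for $0<s\le 1$, $\mathcal H_0=\{R=0,\ u\le u_0\}$, and let $\mathcal S^{s,1}_{u_0}$ be the part of $\{u=u_0\}$ between $\mathcal H_s$ and $\mathcal H_1$. Use the tetrad $\hat l=-\sqrt{F/2}\,\partial_R$, $\hat n=\sqrt{2/F}\,(\partial_u+\tfrac12R^2F\,\partial_R)$, $\hat m=\tfrac1{\sqrt2}(\partial_\theta+\tfrac{i}{\sin\theta}\partial_\varphi)$. For a rescaled Maxwell spinor field $\hat\phi_{AB}$ with components $\hat\phi_0,\hat\phi_1,\hat\phi_2$ in the associated spin-frame, let $T=u^2\partial_u-2(1+uR)\partial_R$ be the Morawetz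 vector field, $V^a=T_b\,\hat\phi^{AB}\bar{\hat\phi}{}^{A'B'}$ (where $T_b=T_{BB'}$), and let $\mathcal E_{\mathcal H_s}$ and $\mathcal E_{\mathcal S^{s,1}_{u_0}}$ be the integrals of the $3$-form $V\lrcorner\,\mathrm{dVol}^4$, $\mathrm{dVol}^4=-du\wedge dR\wedge d^2\omega$. Explicitly, for $0<s\le1$, $$\mathcal E_{\mathcal H_s}=\int_{\mathcal H_s}\Big(\big(\tfrac2s-1\big)R^2\big(2+2uR+\tfrac{(uR)^2F}{2}\big)|\hat\phi_0|^2+\big(2+2uR+\tfrac{(uR)^2F}{s}\big)|\hat\phi_1|^2+\tfrac F2u^2|\hat\phi_2|^2\Big)\,du\,d^2\omega,$$ $$\mathcal E_{\mathcal H_0}=\int_{\mathcal H_0}\big(2|\hat\phi_1|^2+\tfrac{u^2}{2}|\hat\phi_2|^2\big)\,du\,d^2\omega,\qquad \mathcal E_{\mathcal S^{s,1}_{u_0}}=\int_{\mathcal S^{s,1}_{u_0}}\Big(\tfrac2F\big(2+2uR+\tfrac{(uR)^2F}{2}\big)|\hat\phi_0|^2+u^2|\hat\phi_1|^2\Big)\,dR\,d^2\omega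 .$$ For every $u_0<0$ with $|u_0|$ large enough (depending on $m$) there is a constant $C>0$ such that, for every smooth solution $\hat\phi_{AB}$ on $\Omega^+_{u_0}$ (smooth up to the boundary, including null infinity) of the rescaled Maxwell equations $\hat\nabla^{AA'}\hat\phi_{AB}=0$ whose data on $\mathcal H_1$ (which then satisfy the constraints) are supported away from $i^0$, i.e. vanish for $u$ close to $-\infty$, and for every $0\le s<1$, the energies below are finite and $$\mathcal E_{\mathcal H_s}(\hat\phi_{AB})\le C\,\mathcal E_{\mathcal H_1}(\hat\phi_{AB}),\qquad \mathcal E_{\mathcal H_1}(\hat\phi_{AB})\le C\big(\mathcal E_{\mathcal H_s}(\hat\phi_{AB})+\mathcal E_{\mathcal S^{s,1}_{u_0}}(\hat\phi_{AB})\big).$$ -/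

import Mathlib

open Set MeasureTheory
open scoped ContDiff Manifold

namespace MaxwellPeeling

noncomputable section

/-! Geometry: the exterior of the Schwarzschild black hole of mass `m`, with the coordinates
`u = t - r_*`, `R = 1/r`, `ω ∈ S²`, and the metric `R² F du² - 2 du dR - dω²`. -/

/-- `F = 1 - 2 m R`. -/
def lapse (m R : ℝ) : ℝ := 1 - 2 * m * R

/-- The Regge-Wheeler coordinate `r_* = r + 2 m log (r - 2 m)`, for `r > 2 m`. -/
def tortoise (m r : ℝ) : ℝ := r + 2 * m * Real.log (r - 2 * m)

/-- `r ↦ r_*` is a bijection from `]2m, +∞[` onto `ℝ`. -/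
theorem tortoise_bijOn {m : ℝ} (hm : 0 < m) : BijOn (tortoise m) (Ioi (2 * m)) univ := by
  have hmono : StrictMonoOn (tortoise m) (Ioi (2 * m)) := by
    intro a ha b _ hab
    have ha' : 0 < a - 2 * m := sub_pos.2 ha
    have hlog : Real.log (a - 2 * m) < Real.log (b - 2 * m) :=
      Real.log_lt_log ha' (by linarith)
    have := mul_lt_mul_of_pos_left hlog (by linarith : 0 < 2 * m)
    simp only [tortoise]
    linarith
  have hcont : ContinuousOn (tortoise m) (Ioi (2 * m)) := by
    unfold tortoise
    refine continuousOn_id.add (continuousOn_const.mul (ContinuousOn.log (by fun_prop) ?_))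
    intro x hx
    exact (sub_pos.2 hx).ne'
  refine ⟨fun _ _ => mem_univ _, hmono.injOn, ?_⟩
  intro y _
  -- below `y` the logarithm dominates, above `y` the identity dominates
  set d : ℝ := min 1 (Real.exp ((y - 2 * m - 1) / (2 * m))) with hd
  have hd0 : 0 < d := lt_min one_pos (Real.exp_pos _)
  have hlow : tortoise m (2 * m + d) ≤ y := by
    have h1 : d ≤ 1 := min_le_left _ _
    have h2 : Real.log d ≤ (y - 2 * m - 1) / (2 * m) := by
      have := Real.log_le_log hd0 (min_le_right 1 (Real.exp ((y - 2 * m - 1) / (2 * m))))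
      rwa [Real.log_exp] at this
    have h3 : 2 * m * Real.log d ≤ y - 2 * m - 1 := by
      rw [le_div_iff₀ (by linarith)] at h2
      linarith
    simp only [tortoise, add_sub_cancel_left]
    linarith
  set b : ℝ := 2 * m + 1 + |y| with hb
  have hhigh : y ≤ tortoise m b := by
    have h1 : 0 ≤ Real.log (b - 2 * m) :=
      Real.log_nonneg (by have := abs_nonneg y; rw [hb]; linarith)
    have h2 := le_abs_self y
    have h3 : 0 ≤ 2 * m * Real.log (b - 2 * m) := by positivity
    simp only [tortoise]
    linarith
  have hle : 2 * m + d ≤ b := by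
    have h1 : d ≤ 1 := min_le_left _ _
    have := abs_nonneg y
    linarith
  have hsub : Icc (2 * m + d) b ⊆ Ioi (2 * m) := fun x hx =>
    lt_of_lt_of_le (by linarith) hx.1
  obtain ⟨x, hx, hxy⟩ := intermediate_value_Icc hle (hcont.mono hsub) ⟨hlow, hhigh⟩
  exact ⟨x, hsub hx, hxy⟩

/-- The radius `r > 2 m` at which `r_*` takes the value `x`. -/
def radius (m x : ℝ) : ℝ := Function.invFunOn (tortoise m) (Ioi (2 * m)) x

/-- The domain `Ω⁺_{u₀} = {u ≤ u₀, 0 ≤ t ≤ +∞}` in the variables `(u, R)`; the points with `R = 0`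
(that is, `t = +∞`) are those of future null infinity. -/
def domain (m u₀ : ℝ) : Set (ℝ × ℝ) :=
  {q | q.1 ≤ u₀ ∧ (q.2 = 0 ∨ (0 < q.2 ∧ 2 * m * q.2 < 1 ∧ 0 ≤ q.1 + tortoise m (1 / q.2)))}

/-- The interior of `domain m u₀`. -/
def domainInterior (m u₀ : ℝ) : Set (ℝ × ℝ) :=
  {q | q.1 < u₀ ∧ 0 < q.2 ∧ 2 * m * q.2 < 1 ∧ 0 < q.1 + tortoise m (1 / q.2)}

/-- The value of `R` at retarded time `u` on the hypersurface `H_s = {u = - s r_*}`; for `s = 0`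
this hypersurface is null infinity, `R = 0`. -/
def hypR (m s u : ℝ) : ℝ := if s = 0 then 0 else 1 / radius m (-u / s)

/-! Fields. -/

/-- Euclidean three-space, in which the unit sphere lies. -/
abbrev E3 : Type := EuclideanSpace ℝ (Fin 3)

/-- The unit sphere `S²`. -/
abbrev S2 : Type := Metric.sphere (0 : E3) 1

instance factFinrankE3 : Fact (Module.finrank ℝ E3 = 2 + 1) := ⟨by simp⟩

/-- The ambient space of the tangent vectors `(X^u, X^R, X^ω)`, where `X^ω ∈ T_ω S² ⊆ ℝ³`. -/
abbrev Vec : Type := ℝ × ℝ × E3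

/-- Real bilinear forms on tangent vectors, at each point `(u, R, ω)`. Only the values on vectors
that are tangent to `ℝ × ℝ × S²` are ever used. -/
abbrev BilinField : Type := ℝ × ℝ × S2 → (Vec →L[ℝ] Vec →L[ℝ] ℝ)

/-- The point of `S²` with polar angle `θ` and azimuth `φ`. -/
def spherePt (θ φ : ℝ) : S2 :=
  ⟨!₂[Real.sin θ * Real.cos φ, Real.sin θ * Real.sin φ, Real.cos θ], by
    rw [mem_sphere_zero_iff_norm, EuclideanSpace.norm_eq, Real.sqrt_eq_one]
    simp only [Fin.sum_univ_three, Real.norm_eq_abs, sq_abs]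
    simp
    nlinarith [Real.sin_sq_add_cos_sq θ, Real.sin_sq_add_cos_sq φ]⟩

/-- `∂_θ`, as a vector of `ℝ³`. -/
def eTheta (θ φ : ℝ) : E3 :=
  !₂[Real.cos θ * Real.cos φ, Real.cos θ * Real.sin φ, -Real.sin θ]

/-- `(1 / sin θ) ∂_φ`, as a vector of `ℝ³`. -/
def ePhi (φ : ℝ) : E3 := !₂[-Real.sin φ, Real.cos φ, 0]

/-- The value of a real bilinear form on the complex vectors `X.1 + i X.2` and `Y.1 + i Y.2`. -/
def cval (B : Vec →L[ℝ] Vec →L[ℝ] ℝ) (X Y : Vec × Vec) : ℂ :=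
  ⟨B X.1 Y.1 - B X.2 Y.2, B X.1 Y.2 + B X.2 Y.1⟩

/-- The tetrad vector `l = - √(F/2) ∂_R` (as a complex vector with zero imaginary part). -/
def tetL (m R : ℝ) : Vec × Vec := ((0, -√(lapse m R / 2), 0), 0)

/-- The tetrad vector `n = √(2/F) (∂_u + (R² F / 2) ∂_R)`. -/
def tetN (m R : ℝ) : Vec × Vec :=
  ((√(2 / lapse m R), √(2 / lapse m R) * (R ^ 2 * lapse m R / 2), 0), 0)

/-- The tetrad vector `(∂_θ + (i / sin θ) ∂_φ) / √2`. -/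
def tetM (θ φ : ℝ) : Vec × Vec :=
  ((0, 0, (1 / √2) • eTheta θ φ), (0, 0, (1 / √2) • ePhi φ))

/-- The complex conjugate of `tetM`. -/
def tetMbar (θ φ : ℝ) : Vec × Vec :=
  ((0, 0, (1 / √2) • eTheta θ φ), (0, 0, -(1 / √2) • ePhi φ))

/-- Complex functions of `(u, R, θ, φ)`. -/
abbrev Comp : Type := ℝ → ℝ → ℝ → ℝ → ℂ

/-- `φ₀ = φ_{AB} o^A o^B`, that is `B(l, m)` for the real two-form
`B = φ_{AB} ε_{A'B'} + complex conjugate`. -/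
def phi0 (m : ℝ) (B : BilinField) : Comp := fun u R θ φ =>
  cval (B (u, R, spherePt θ φ)) (tetL m R) (tetM θ φ)

/-- `φ₁ = φ_{AB} o^A ι^B`, that is `(B(l, n) + B(m̄, m)) / 2`. -/
def phi1 (m : ℝ) (B : BilinField) : Comp := fun u R θ φ =>
  (cval (B (u, R, spherePt θ φ)) (tetL m R) (tetN m R) +
    cval (B (u, R, spherePt θ φ)) (tetMbar θ φ) (tetM θ φ)) / 2

/-- `φ₂ = φ_{AB} ι^A ι^B`, that is `B(m̄, n)`. -/
def phi2 (m : ℝ) (B : BilinField) : Comp := fun u R θ φ =>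
  cval (B (u, R, spherePt θ φ)) (tetMbar θ φ) (tetN m R)

/-! The partial derivatives. -/

def dU (f : Comp) : Comp := fun u R θ φ => deriv (fun x => f x R θ φ) u
def dR (f : Comp) : Comp := fun u R θ φ => deriv (fun x => f u x θ φ) R
def dTheta (f : Comp) : Comp := fun u R θ φ => deriv (fun x => f u R x φ) θ
def dPhi (f : Comp) : Comp := fun u R θ φ => deriv (fun x => f u R θ x) φ

/-- The derivative along `l`. -/
def opD (m : ℝ) (f : Comp) : Comp := fun u R θ φ =>
  -((√(lapse m R / 2) : ℝ) : ℂ) * dR f u R θ φ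

/-- The derivative along `n`. -/
def opD' (m : ℝ) (f : Comp) : Comp := fun u R θ φ =>
  ((√(2 / lapse m R) : ℝ) : ℂ) *
    (dU f u R θ φ + ((R ^ 2 * lapse m R / 2 : ℝ) : ℂ) * dR f u R θ φ)

/-- The derivative along the tetrad vector `tetM`. -/
def opDelta (f : Comp) : Comp := fun u R θ φ =>
  ((1 / √2 : ℝ) : ℂ) * (dTheta f u R θ φ + Complex.I / (Real.sin θ : ℂ) * dPhi f u R θ φ)

/-- The derivative along the tetrad vector `tetMbar`. -/
def opDelta' (f : Comp) : Comp := fun u R θ φ =>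
  ((1 / √2 : ℝ) : ℂ) * (dTheta f u R θ φ - Complex.I / (Real.sin θ : ℂ) * dPhi f u R θ φ)

/-- The spin coefficient `ε` (`κ, σ, λ, τ, ν, π, ρ, μ` vanish for this tetrad). -/
def spinEps (m R : ℝ) : ℝ := m / (2 * √(2 * lapse m R))

/-- The spin coefficient `γ`. -/
def spinGamma (m R : ℝ) : ℝ := (5 * m * R ^ 2 - 2 * R) / (2 * √(2 * lapse m R))

/-- The spin coefficient `β = - α`. -/
def spinBeta (θ : ℝ) : ℝ := Real.cos θ / Real.sin θ / (2 * √2)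

/-- The field is a real two-form, smooth on `domain m u₀ × S²` up to the boundary, and its spinor
`φ_{AB}` solves the rescaled Maxwell equation `∇^{AA'} φ_{AB} = 0`, which is written out as the four
component equations in the Newman-Penrose tetrad. -/
structure IsMaxwellField (m u₀ : ℝ) (B : BilinField) : Prop where
  skew : ∀ p : ℝ × ℝ × S2, (p.1, p.2.1) ∈ domain m u₀ → ∀ X Y : Vec, B p X Y = -B p Y X
  smooth : ContMDiffOn (𝓘(ℝ, ℝ).prod (𝓘(ℝ, ℝ).prod (𝓡 2))) 𝓘(ℝ, Vec →L[ℝ] Vec →L[ℝ] ℝ) ∞ B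
    {p | (p.1, p.2.1) ∈ domain m u₀}
  eq1 : ∀ u R θ φ : ℝ, (u, R) ∈ domainInterior m u₀ → θ ∈ Ioo 0 Real.pi →
    opD' m (phi0 m B) u R θ φ - opDelta (phi1 m B) u R θ φ
      - 2 * (spinGamma m R : ℂ) * phi0 m B u R θ φ = 0
  eq2 : ∀ u R θ φ : ℝ, (u, R) ∈ domainInterior m u₀ → θ ∈ Ioo 0 Real.pi →
    opD m (phi1 m B) u R θ φ - opDelta' (phi0 m B) u R θ φ
      - 2 * (spinBeta θ : ℂ) * phi0 m B u R θ φ = 0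
  eq3 : ∀ u R θ φ : ℝ, (u, R) ∈ domainInterior m u₀ → θ ∈ Ioo 0 Real.pi →
    opD' m (phi1 m B) u R θ φ - opDelta (phi2 m B) u R θ φ
      - 2 * (spinBeta θ : ℂ) * phi2 m B u R θ φ = 0
  eq4 : ∀ u R θ φ : ℝ, (u, R) ∈ domainInterior m u₀ → θ ∈ Ioo 0 Real.pi →
    opD m (phi2 m B) u R θ φ - opDelta' (phi1 m B) u R θ φ
      + 2 * (spinEps m R : ℂ) * phi2 m B u R θ φ = 0

/-- The restriction of the field to `H₁ = {t = 0, u ≤ u₀}` is supported away from spacelike infinity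
`i⁰`, that is, from the end `u = - r_* → - ∞` of `H₁`. -/
def DataSupportedAwayFromI0 (m u₀ : ℝ) (B : BilinField) : Prop :=
  ∃ L : ℝ, ∀ u ≤ u₀, u < L → ∀ θ ∈ Ioo 0 Real.pi, ∀ φ : ℝ,
    phi0 m B u (hypR m 1 u) θ φ = 0 ∧ phi1 m B u (hypR m 1 u) θ φ = 0 ∧
      phi2 m B u (hypR m 1 u) θ φ = 0

/-! Energies: the Morawetz vector field is `T = u² ∂_u - 2 (1 + u R) ∂_R`, the stress-energy tensor
`φ_{AB} φ̄_{A'B'}`, the current `V^a = T^{ab} T_b`, and the energy on an oriented hypersurface is the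
integral of the contraction of `V` with the volume form `- du ∧ dR ∧ d²ω`. -/

/-- The component of `T` along `l`. -/
def morawetzL (m u R : ℝ) : ℝ :=
  √(2 / lapse m R) * (2 * (1 + u * R) + (u * R) ^ 2 * lapse m R / 2)

/-- The component of `T` along `n`. -/
def morawetzN (m u R : ℝ) : ℝ := u ^ 2 * √(lapse m R / 2)

/-- The component of `V` along `l`. -/
def currentL (m : ℝ) (B : BilinField) (u R θ φ : ℝ) : ℝ :=
  morawetzL m u R * ‖phi1 m B u R θ φ‖ ^ 2 + morawetzN m u R * ‖phi2 m B u R θ φ‖ ^ 2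

/-- The component of `V` along `n`. -/
def currentN (m : ℝ) (B : BilinField) (u R θ φ : ℝ) : ℝ :=
  morawetzL m u R * ‖phi0 m B u R θ φ‖ ^ 2 + morawetzN m u R * ‖phi1 m B u R θ φ‖ ^ 2

/-- `V^u`. -/
def currentU (m : ℝ) (B : BilinField) (u R θ φ : ℝ) : ℝ :=
  √(2 / lapse m R) * currentN m B u R θ φ

/-- `V^R`. -/
def currentR (m : ℝ) (B : BilinField) (u R θ φ : ℝ) : ℝ :=
  -√(lapse m R / 2) * currentL m B u R θ φ
    + √(2 / lapse m R) * (R ^ 2 * lapse m R / 2) * currentN m B u R θ φ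

/-- The angles `(θ, φ)`. -/
def angles : Set (ℝ × ℝ) := Ioo 0 Real.pi ×ˢ Ioo 0 (2 * Real.pi)

/-- The energy density on `H_s` with respect to `du dθ dφ`. On `H_s`, `s > 0`, one has
`dR = (F R² / s) du`, and the density is `sin θ` times
`(2/s - 1) R² (2 + 2uR + (uR)² F/2) |φ₀|² + (2 + 2uR + (uR)² F/s) |φ₁|² + (F/2) u² |φ₂|²`.
On `H_0` one has `R = 0`, `dR = 0`, and it is `sin θ` times `2 |φ₁|² + (u²/2) |φ₂|²`. -/
def densityH (m s : ℝ) (B : BilinField) (x : ℝ × ℝ × ℝ) : ℝ :=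
  (currentU m B x.1 (hypR m s x.1) x.2.1 x.2.2
      * (if s = 0 then 0 else lapse m (hypR m s x.1) * hypR m s x.1 ^ 2 / s)
    - currentR m B x.1 (hypR m s x.1) x.2.1 x.2.2) * Real.sin x.2.1

/-- `H_s`, parametrized by `(u, θ, φ)`. -/
def paramH (u₀ : ℝ) : Set (ℝ × ℝ × ℝ) := Iio u₀ ×ˢ angles

/-- The Morawetz energy on `H_s`. -/
def energyH (m u₀ s : ℝ) (B : BilinField) : ℝ := ∫ x in paramH u₀, densityH m s B x

/-- The energy density on the null hypersurface `S_{u₀}` with respect to `dR dθ dφ`, that is,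
`sin θ` times `(2/F) (2 + 2uR + (uR)² F/2) |φ₀|² + u² |φ₁|²` at `u = u₀`. -/
def densityS (m u₀ : ℝ) (B : BilinField) (x : ℝ × ℝ × ℝ) : ℝ :=
  currentU m B u₀ x.1 x.2.1 x.2.2 * Real.sin x.2.1

/-- The part `S^{s,1}_{u₀}` of `S_{u₀}` between `H_s` and `H_1`, parametrized by `(R, θ, φ)`. -/
def paramS (m u₀ s : ℝ) : Set (ℝ × ℝ × ℝ) := Ioo (hypR m s u₀) (hypR m 1 u₀) ×ˢ angles

/-- The flux through `S^{s,1}_{u₀}`. -/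
def energyS (m u₀ s : ℝ) (B : BilinField) : ℝ := ∫ x in paramS m u₀ s, densityS m u₀ B x

end

end MaxwellPeeling

/-! The energies are fluxes of the Morawetz current `V`, whose divergence on a Maxwell field is
`4 m R² (3 + u R) / F * |φ₀|²`. Far out, `u R` stays close to `[-1, 0]` in the future of `{t = 0}`:
the divergence is nonnegative there, and so is the flux through every spacelike surface. The
divergence theorem between `H_s` and `H_1` thus gives `E(H_1) ≤ E(H_s) + E(S)`.

Conversely, the divergence is bounded by a multiple of `m / u²` times the density `V^u`, so that
multiplying `V` by `exp (160 m / u)` makes it nonpositive. This gives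
`E(H_s) ≤ exp (-160 m / u₀) E(H_1)`, the weight lying between `exp (160 m / u₀)` and `1`.

The same weighted estimate between `{t = 0}` and the spacelike lines `r_* = c - (3/4) u` is a domain
of dependence property: the field vanishes for `u` close to `-∞`, so that all integrals are over
bounded regions on which it is smooth. -/

namespace MaxwellPeeling

noncomputable section

/-- The space of the coordinates `(u, R, θ, φ)`. -/
abbrev Coords : Type := ℝ × ℝ × ℝ × ℝ

/-- The coordinates as an element of `Fin 4 → ℝ`, the form in which Mathlib states the divergence
theorem. -/
def coordsEquivPi : Coords ≃L[ℝ] (Fin 4 → ℝ) where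
  toFun x := ![x.1, x.2.1, x.2.2.1, x.2.2.2]
  invFun y := (y 0, y 1, y 2, y 3)
  map_add' x y := by ext i; fin_cases i <;> rfl
  map_smul' c x := by ext i; fin_cases i <;> rfl
  left_inv _ := rfl
  right_inv y := by ext i; fin_cases i <;> rfl
  continuous_toFun := by fun_prop
  continuous_invFun := by fun_prop

theorem coordsEquivPi_apply (x : Coords) : coordsEquivPi x = ![x.1, x.2.1, x.2.2.1, x.2.2.2] := rfl

theorem coordsEquivPi_symm_apply (y : Fin 4 → ℝ) :
    coordsEquivPi.symm y = (y 0, y 1, y 2, y 3) := rfl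

theorem volume_preserving_pi_fin_three_prod :
    MeasurePreserving (fun y : Fin 3 → ℝ => (y 0, y 1, y 2)) :=
  ((MeasurePreserving.id volume).prod (volume_preserving_finTwoArrow ℝ)).comp
    (volume_preserving_piFinSuccAbove (fun _ : Fin 3 => ℝ) 0)

theorem volume_preserving_coordsEquivPi : MeasurePreserving coordsEquivPi := by
  have hsymm : MeasurePreserving coordsEquivPi.symm :=
    ((MeasurePreserving.id volume).prod volume_preserving_pi_fin_three_prod).comp
      (volume_preserving_piFinSuccAbove (fun _ : Fin 4 => ℝ) 0)
  exact hsymm.symm coordsEquivPi.symm.toHomeomorph.toMeasurableEquiv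

theorem setIntegral_Icc_pi_fin_three (a b : Fin 3 → ℝ) (f : (Fin 3 → ℝ) → ℝ) :
    ∫ y in Icc a b, f y =
      ∫ y in Icc (a 0, a 1, a 2) (b 0, b 1, b 2), f ![y.1, y.2.1, y.2.2] := by
  have hemb : MeasurableEmbedding (fun y : Fin 3 → ℝ => (y 0, y 1, y 2)) :=
    (((MeasurableEquiv.piFinSuccAbove (fun _ : Fin 3 => ℝ) 0).trans
      ((MeasurableEquiv.refl ℝ).prodCongr MeasurableEquiv.finTwoArrow))).measurableEmbedding
  have hset : Icc a b = (fun y : Fin 3 → ℝ => (y 0, y 1, y 2)) ⁻¹'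
      Icc (a 0, a 1, a 2) (b 0, b 1, b 2) := by
    ext y
    simp [Pi.le_def, Fin.forall_fin_succ]
  rw [hset, ← volume_preserving_pi_fin_three_prod.setIntegral_preimage_emb hemb]
  congr with y
  congr with i
  fin_cases i <;> rfl

section Slices

variable {E : Type*} [NormedAddCommGroup E] [NormedSpace ℝ E] {f : Coords → E} {x : Coords}

theorem hasDerivAt_slice_u (hf : DifferentiableAt ℝ f x) :
    HasDerivAt (fun t => f (t, x.2)) (fderiv ℝ f x (1, 0)) x.1 :=
  HasFDerivAt.comp_hasDerivAt_of_eq x.1 hf.hasFDerivAt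
    ((hasDerivAt_id x.1).prodMk (hasDerivAt_const x.1 x.2)) rfl

theorem hasDerivAt_slice_R (hf : DifferentiableAt ℝ f x) :
    HasDerivAt (fun t => f (x.1, t, x.2.2)) (fderiv ℝ f x (0, 1, 0)) x.2.1 :=
  HasFDerivAt.comp_hasDerivAt_of_eq x.2.1 hf.hasFDerivAt
    ((hasDerivAt_const _ x.1).prodMk ((hasDerivAt_id _).prodMk (hasDerivAt_const _ x.2.2))) rfl

theorem hasDerivAt_slice_theta (hf : DifferentiableAt ℝ f x) :
    HasDerivAt (fun t => f (x.1, x.2.1, t, x.2.2.2)) (fderiv ℝ f x (0, 0, 1, 0)) x.2.2.1 :=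
  HasFDerivAt.comp_hasDerivAt_of_eq x.2.2.1 hf.hasFDerivAt
    ((hasDerivAt_const _ x.1).prodMk ((hasDerivAt_const _ x.2.1).prodMk
      ((hasDerivAt_id _).prodMk (hasDerivAt_const _ x.2.2.2)))) rfl

theorem hasDerivAt_slice_phi (hf : DifferentiableAt ℝ f x) :
    HasDerivAt (fun t => f (x.1, x.2.1, x.2.2.1, t)) (fderiv ℝ f x (0, 0, 0, 1)) x.2.2.2 :=
  HasFDerivAt.comp_hasDerivAt_of_eq x.2.2.2 hf.hasFDerivAt
    ((hasDerivAt_const _ x.1).prodMk ((hasDerivAt_const _ x.2.1).prodMk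
      ((hasDerivAt_const _ x.2.2.1).prodMk (hasDerivAt_id _)))) rfl

end Slices

/-- The divergence of a vector field in the coordinates `(u, R, θ, φ)`, with respect to the volume
element `du dR dθ dφ`. -/
def divergence (X : Coords → Coords) (x : Coords) : ℝ :=
  (fderiv ℝ X x (1, 0)).1 + (fderiv ℝ X x (0, 1, 0)).2.1 + (fderiv ℝ X x (0, 0, 1, 0)).2.2.1 +
    (fderiv ℝ X x (0, 0, 0, 1)).2.2.2

theorem divergence_eq_of_hasDerivAt {X : Coords → Coords} {x : Coords}
    (hX : DifferentiableAt ℝ X x) {a b c d : ℝ}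
    (ha : HasDerivAt (fun t => (X (t, x.2)).1) a x.1)
    (hb : HasDerivAt (fun t => (X (x.1, t, x.2.2)).2.1) b x.2.1)
    (hc : HasDerivAt (fun t => (X (x.1, x.2.1, t, x.2.2.2)).2.2.1) c x.2.2.1)
    (hd : HasDerivAt (fun t => (X (x.1, x.2.1, x.2.2.1, t)).2.2.2) d x.2.2.2) :
    divergence X x = a + b + c + d := by
  let pr₂ := ContinuousLinearMap.snd ℝ ℝ (ℝ × ℝ × ℝ)
  let pr₃ := (ContinuousLinearMap.snd ℝ ℝ (ℝ × ℝ)).comp pr₂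
  rw [ha.unique ((ContinuousLinearMap.fst ℝ ℝ (ℝ × ℝ × ℝ)).hasFDerivAt.comp_hasDerivAt _
      (hasDerivAt_slice_u hX)),
    hb.unique (((ContinuousLinearMap.fst ℝ ℝ (ℝ × ℝ)).comp pr₂).hasFDerivAt.comp_hasDerivAt _
      (hasDerivAt_slice_R hX)),
    hc.unique (((ContinuousLinearMap.fst ℝ ℝ ℝ).comp pr₃).hasFDerivAt.comp_hasDerivAt _
      (hasDerivAt_slice_theta hX)),
    hd.unique (((ContinuousLinearMap.snd ℝ ℝ ℝ).comp pr₃).hasFDerivAt.comp_hasDerivAt _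
      (hasDerivAt_slice_phi hX))]
  rfl

/-- The fluxes of `X` through opposite sides of the rectangle `[c, d]` of angles cancel: this is how
both the vanishing of a field at the poles of the sphere and its periodicity in the azimuth enter
the divergence theorem. -/
structure HasBalancedSides (X : Coords → Coords) (c d : ℝ × ℝ) : Prop where
  polar : ∀ u R φ, (X (u, R, c.1, φ)).2.2.1 = (X (u, R, d.1, φ)).2.2.1
  azimuthal : ∀ u R θ, (X (u, R, θ, c.2)).2.2.2 = (X (u, R, θ, d.2)).2.2.2

theorem setIntegral_divergence_Icc {X : Coords → Coords} {a b : Coords} (hab : a ≤ b)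
    (hc : ContinuousOn X (Icc a b)) (hd : ∀ x ∈ interior (Icc a b), DifferentiableAt ℝ X x)
    (hi : IntegrableOn (divergence X) (Icc a b)) (hs : HasBalancedSides X a.2.2 b.2.2) :
    ∫ x in Icc a b, divergence X x =
      (∫ y in Icc a.2 b.2, (X (b.1, y)).1) - (∫ y in Icc a.2 b.2, (X (a.1, y)).1)
        + ((∫ y in Icc (a.1, a.2.2) (b.1, b.2.2), (X (y.1, b.2.1, y.2)).2.1)
        - ∫ y in Icc (a.1, a.2.2) (b.1, b.2.2), (X (y.1, a.2.1, y.2)).2.1) := by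
  let pr (i : Fin 4) : Coords →L[ℝ] ℝ :=
    (ContinuousLinearMap.proj i).comp (coordsEquivPi : Coords →L[ℝ] Fin 4 → ℝ)
  have key := integral_divergence_of_hasFDerivAt_off_countable_of_equiv coordsEquivPi
    (fun x y => by simp [coordsEquivPi_apply, Pi.le_def, Fin.forall_fin_succ, Prod.le_def])
    volume_preserving_coordsEquivPi (fun i x => pr i (X x)) (fun i x => (pr i).comp (fderiv ℝ X x))
    ∅ countable_empty a b hab (fun i => (pr i).continuous.comp_continuousOn hc)
    (fun x hx i => (pr i).hasFDerivAt.comp x (hd x hx.1).hasFDerivAt) (divergence X)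
    (fun x => ?_) hi
  · have polar (y : ℝ × ℝ × ℝ) :
        pr 2 (X (coordsEquivPi.symm
          ((2 : Fin 4).insertNth (coordsEquivPi b 2) ![y.1, y.2.1, y.2.2]))) =
        pr 2 (X (coordsEquivPi.symm
          ((2 : Fin 4).insertNth (coordsEquivPi a 2) ![y.1, y.2.1, y.2.2]))) :=
      (hs.polar _ _ _).symm
    have azimuthal (y : ℝ × ℝ × ℝ) :
        pr 3 (X (coordsEquivPi.symm
          ((3 : Fin 4).insertNth (coordsEquivPi b 3) ![y.1, y.2.1, y.2.2]))) =
        pr 3 (X (coordsEquivPi.symm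
          ((3 : Fin 4).insertNth (coordsEquivPi a 3) ![y.1, y.2.1, y.2.2]))) :=
      (hs.azimuthal _ _ _).symm
    rw [key, Fin.sum_univ_four]
    simp only [setIntegral_Icc_pi_fin_three, polar, azimuthal, sub_self, add_zero]
    rfl
  · have basis (i : Fin 4) : coordsEquivPi.symm (Pi.single i 1) =
        ![((1, 0) : Coords), (0, 1, 0), (0, 0, 1, 0), (0, 0, 0, 1)] i := by
      fin_cases i <;> simp [coordsEquivPi_symm_apply]
    rw [Fin.sum_univ_four]
    simp only [basis]
    rfl

theorem HasBalancedSides.smul {X : Coords → Coords} {c d : ℝ × ℝ} (hX : HasBalancedSides X c d)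
    (w : ℝ → ℝ) : HasBalancedSides (fun x => w x.1 • X x) c d where
  polar u R φ := congrArg (w u • ·) (hX.polar u R φ)
  azimuthal u R θ := congrArg (w u • ·) (hX.azimuthal u R θ)

theorem divergence_smul {X : Coords → Coords} {x : Coords} {w : ℝ → ℝ} {w' : ℝ}
    (hw : HasDerivAt w w' x.1) (hX : DifferentiableAt ℝ X x) :
    divergence (fun x => w x.1 • X x) x = w' * (X x).1 + w x.1 * divergence X x := by
  have h : HasFDerivAt (fun x => w x.1 • X x) _ x :=
    (hw.comp_hasFDerivAt x hasFDerivAt_fst).smul hX.hasFDerivAt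
  simp only [divergence, h.fderiv, add_apply, smul_apply, Function.comp_apply,
    ContinuousLinearMap.smulRight_apply, ContinuousLinearMap.coe_fst', Prod.fst_add, Prod.snd_add,
    Prod.smul_fst, Prod.smul_snd, smul_eq_mul]
  ring

theorem det_id_add_smulRight {E : Type*} [NormedAddCommGroup E] [NormedSpace ℝ E]
    [FiniteDimensional ℝ E] (f : E →L[ℝ] ℝ) (v : E) :
    (ContinuousLinearMap.id ℝ E + f.smulRight v).det = 1 + f v :=
  LinearMap.transvection.det (f : E →ₗ[ℝ] ℝ) v

instance isAddHaarMeasure_volume_prod_three : (volume : Measure (ℝ × ℝ × ℝ)).IsAddHaarMeasure :=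
  Measure.prod.instIsAddHaarMeasure volume volume

instance isAddHaarMeasure_volume_coords : (volume : Measure Coords).IsAddHaarMeasure :=
  Measure.prod.instIsAddHaarMeasure volume volume

/-- The chart `(u, τ, ξ) ↦ (u, (1 - τ) p(u) + τ q(u), ξ)` of the region between two graphs. -/
def graphChart (p q : ℝ → ℝ) (x : Coords) : Coords :=
  (x.1, p x.1 + x.2.1 * (q x.1 - p x.1), x.2.2)

/-- The open region between the graphs of `p` and `q` over `]α, β[`, with angles in `T`. -/
def graphRegion (p q : ℝ → ℝ) (α β : ℝ) (T : Set (ℝ × ℝ)) : Set Coords :=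
  {x | x.1 ∈ Ioo α β ∧ x.2.1 ∈ Ioo (p x.1) (q x.1) ∧ x.2.2 ∈ T}

/-- The closed region between the graphs of `p` and `q` over `[α, β]`, with angles in `T`. -/
def closedGraphRegion (p q : ℝ → ℝ) (α β : ℝ) (T : Set (ℝ × ℝ)) : Set Coords :=
  {x | x.1 ∈ Icc α β ∧ x.2.1 ∈ Icc (p x.1) (q x.1) ∧ x.2.2 ∈ T}

/-- The flux density of `X` through the graph `R = p(u)`, with respect to `du dθ dφ`. -/
def graphFlux (X : Coords → Coords) (p : ℝ → ℝ) (y : ℝ × ℝ × ℝ) : ℝ :=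
  deriv p y.1 * (X (y.1, p y.1, y.2)).1 - (X (y.1, p y.1, y.2)).2.1

/-- The Piola transform of `X` under `graphChart p q`: the field on the box whose fluxes are those
of `X`. -/
def graphPullback (p q : ℝ → ℝ) (X : Coords → Coords) (x : Coords) : Coords :=
  ((q x.1 - p x.1) * (X (graphChart p q x)).1,
    (X (graphChart p q x)).2.1
      - (deriv p x.1 + x.2.1 * (deriv q x.1 - deriv p x.1)) * (X (graphChart p q x)).1,
    (q x.1 - p x.1) • (X (graphChart p q x)).2.2)

section GraphRegion

variable {p q : ℝ → ℝ} {α β : ℝ} {T : Set (ℝ × ℝ)} {X : Coords → Coords}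

theorem differentiable_graphChart (hp : Differentiable ℝ p) (hq : Differentiable ℝ q) :
    Differentiable ℝ (graphChart p q) := by
  unfold graphChart
  fun_prop

theorem hasFDerivAt_graphChart (hp : Differentiable ℝ p) (hq : Differentiable ℝ q) (x : Coords) :
    HasFDerivAt (graphChart p q) (ContinuousLinearMap.id ℝ Coords +
      ((deriv p x.1 + x.2.1 * (deriv q x.1 - deriv p x.1)) • ContinuousLinearMap.fst ℝ ℝ _
        + (q x.1 - p x.1 - 1) • (ContinuousLinearMap.fst ℝ ℝ _).comp
          (ContinuousLinearMap.snd ℝ ℝ (ℝ × ℝ × ℝ))).smulRight ((0, 1, 0) : Coords)) x := by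
  have hfst := (ContinuousLinearMap.fst ℝ ℝ (ℝ × ℝ × ℝ)).hasFDerivAt (x := x)
  have hsnd := (ContinuousLinearMap.snd ℝ ℝ (ℝ × ℝ × ℝ)).hasFDerivAt (x := x)
  have hp' := (hp x.1).hasDerivAt.comp_hasFDerivAt x hfst
  have hq' := (hq x.1).hasDerivAt.comp_hasFDerivAt x hfst
  have hΦ := hfst.prodMk ((hp'.add (hsnd.fst.mul (hq'.sub hp'))).prodMk hsnd.snd)
  refine hΦ.congr_fderiv ?_
  ext <;> simp

theorem graphChart_mapsTo (hpq : ∀ u ∈ Icc α β, p u ≤ q u) :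
    MapsTo (graphChart p q) (Icc α β ×ˢ Icc 0 1 ×ˢ T) (closedGraphRegion p q α β T) := by
  rintro ⟨u, τ, ξ⟩ ⟨hu, ⟨h0, h1⟩, hξ⟩
  have h := hpq u hu
  exact ⟨hu, ⟨by dsimp [graphChart]; nlinarith, by dsimp [graphChart]; nlinarith⟩, hξ⟩

theorem isOpen_graphRegion (hp : Continuous p) (hq : Continuous q) (hT : IsOpen T) :
    IsOpen (graphRegion p q α β T) :=
  (isOpen_Ioo.preimage continuous_fst).inter
    (((isOpen_lt (hp.comp continuous_fst) continuous_snd.fst).inter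
      (isOpen_lt continuous_snd.fst (hq.comp continuous_fst))).inter
        (hT.preimage continuous_snd.snd))

theorem graphChart_bijOn (hpq : ∀ u ∈ Ioo α β, p u < q u) :
    BijOn (graphChart p q) (Ioo α β ×ˢ Ioo 0 1 ×ˢ T) (graphRegion p q α β T) := by
  refine ⟨?_, ?_, ?_⟩
  · rintro ⟨u, τ, ξ⟩ ⟨hu, ⟨h0, h1⟩, hξ⟩
    have h := hpq u hu
    exact ⟨hu, ⟨by dsimp [graphChart]; nlinarith, by dsimp [graphChart]; nlinarith⟩, hξ⟩
  · rintro ⟨u, τ, ξ⟩ ⟨hu, -, -⟩ ⟨u', τ', ξ'⟩ - h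
    simp only [graphChart, Prod.mk.injEq] at h
    obtain ⟨rfl, hτ, rfl⟩ := h
    rw [mul_right_cancel₀ (sub_pos.2 (hpq u hu)).ne' (add_left_cancel hτ)]
  · rintro ⟨u, R, ξ⟩ ⟨hu, ⟨h0, h1⟩, hξ⟩
    have h := sub_pos.2 (hpq u hu)
    refine ⟨(u, (R - p u) / (q u - p u), ξ), ⟨hu, ⟨div_pos (sub_pos.2 h0) h, ?_⟩, hξ⟩, ?_⟩
    · exact (div_lt_one h).2 (sub_lt_sub_right h1 _)
    · simp [graphChart, div_mul_cancel₀ _ h.ne']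

theorem setIntegral_graphRegion (hp : Differentiable ℝ p) (hq : Differentiable ℝ q)
    (hpq : ∀ u ∈ Ioo α β, p u < q u) (hT : MeasurableSet T) (f : Coords → ℝ) :
    ∫ x in graphRegion p q α β T, f x =
      ∫ x in Ioo α β ×ˢ Ioo 0 1 ×ˢ T, (q x.1 - p x.1) * f (graphChart p q x) := by
  have hs : MeasurableSet (Ioo α β ×ˢ Ioo (0 : ℝ) 1 ×ˢ T) :=
    measurableSet_Ioo.prod (measurableSet_Ioo.prod hT)
  rw [← (graphChart_bijOn hpq).image_eq, integral_image_eq_integral_abs_det_fderiv_smul volume hs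
    (fun x _ => (hasFDerivAt_graphChart hp hq x).hasFDerivWithinAt) (graphChart_bijOn hpq).injOn]
  refine setIntegral_congr_fun hs fun x hx => ?_
  simp [det_id_add_smulRight, abs_of_pos (sub_pos.2 (hpq x.1 hx.1))]

theorem integrableOn_graphRegion_iff (hp : Differentiable ℝ p) (hq : Differentiable ℝ q)
    (hpq : ∀ u ∈ Ioo α β, p u < q u) (hT : MeasurableSet T) {f : Coords → ℝ} :
    IntegrableOn f (graphRegion p q α β T) ↔
      IntegrableOn (fun x => (q x.1 - p x.1) * f (graphChart p q x))
        (Ioo α β ×ˢ Ioo 0 1 ×ˢ T) := by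
  have hs : MeasurableSet (Ioo α β ×ˢ Ioo (0 : ℝ) 1 ×ˢ T) :=
    measurableSet_Ioo.prod (measurableSet_Ioo.prod hT)
  rw [← (graphChart_bijOn hpq).image_eq, integrableOn_image_iff_integrableOn_abs_det_fderiv_smul
    volume hs (fun x _ => (hasFDerivAt_graphChart hp hq x).hasFDerivWithinAt)
    (graphChart_bijOn hpq).injOn]
  refine integrableOn_congr_fun (fun x hx => ?_) hs
  simp [det_id_add_smulRight, abs_of_pos (sub_pos.2 (hpq x.1 hx.1))]

theorem setIntegral_Ioo_prod_eq_rescale {a b : ℝ} (hab : a ≤ b) (hT : MeasurableSet T)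
    (f : ℝ × ℝ × ℝ → ℝ) :
    ∫ y in Ioo a b ×ˢ T, f y =
      ∫ y in Ioo 0 1 ×ˢ T, (b - a) * f (a + y.1 * (b - a), y.2) := by
  rcases hab.eq_or_lt with rfl | hab
  · simp
  have h := sub_pos.2 hab
  let Φ : ℝ × ℝ × ℝ → ℝ × ℝ × ℝ := fun y => (a + y.1 * (b - a), y.2)
  have hΦ (y) : HasFDerivAt Φ (ContinuousLinearMap.id ℝ _ +
      ((b - a - 1) • ContinuousLinearMap.fst ℝ ℝ (ℝ × ℝ)).smulRight ((1, 0) : ℝ × ℝ × ℝ)) y := by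
    have hfst := (ContinuousLinearMap.fst ℝ ℝ (ℝ × ℝ)).hasFDerivAt (x := y)
    refine (((hfst.mul_const (b - a)).const_add a).prodMk hasFDerivAt_snd).congr_fderiv ?_
    ext <;> simp
  have hbij : BijOn Φ (Ioo 0 1 ×ˢ T) (Ioo a b ×ˢ T) := by
    refine ⟨?_, ?_, ?_⟩
    · rintro ⟨τ, ξ⟩ ⟨⟨h0, h1⟩, hξ⟩
      exact ⟨⟨by dsimp [Φ]; nlinarith, by dsimp [Φ]; nlinarith⟩, hξ⟩
    · rintro ⟨τ, ξ⟩ - ⟨τ', ξ'⟩ - heq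
      simp only [Φ, Prod.mk.injEq] at heq
      rw [mul_right_cancel₀ h.ne' (add_left_cancel heq.1), heq.2]
    · rintro ⟨R, ξ⟩ ⟨⟨h0, h1⟩, hξ⟩
      refine ⟨((R - a) / (b - a), ξ), ⟨⟨div_pos (sub_pos.2 h0) h, ?_⟩, hξ⟩, ?_⟩
      · exact (div_lt_one h).2 (sub_lt_sub_right h1 _)
      · simp [Φ, div_mul_cancel₀ _ h.ne']
  rw [← hbij.image_eq, integral_image_eq_integral_abs_det_fderiv_smul volume
    (measurableSet_Ioo.prod hT) (fun y _ => (hΦ y).hasFDerivWithinAt) hbij.injOn]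
  simp [Φ, det_id_add_smulRight, abs_of_pos h]

theorem differentiableAt_graphPullback (hp : ContDiff ℝ 2 p) (hq : ContDiff ℝ 2 q) {x : Coords}
    (hX : DifferentiableAt ℝ X (graphChart p q x)) :
    DifferentiableAt ℝ (graphPullback p q X) x := by
  have hp' := hp.differentiable_deriv_two
  have hq' := hq.differentiable_deriv_two
  have hp := hp.differentiable two_ne_zero
  have hq := hq.differentiable two_ne_zero
  have hXΦ := hX.comp x (differentiable_graphChart hp hq x)
  have width : DifferentiableAt ℝ (fun x : Coords => q x.1 - p x.1) x := by fun_prop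
  have slope : DifferentiableAt ℝ
      (fun x : Coords => deriv p x.1 + x.2.1 * (deriv q x.1 - deriv p x.1)) x := by fun_prop
  exact (width.mul hXΦ.fst).prodMk
    ((hXΦ.snd.fst.sub (slope.mul hXΦ.fst)).prodMk (width.smul hXΦ.snd.snd))

theorem continuousOn_graphPullback (hp : ContDiff ℝ 2 p) (hq : ContDiff ℝ 2 q)
    (hpq : ∀ u ∈ Icc α β, p u ≤ q u) (hX : ContinuousOn X (closedGraphRegion p q α β T)) :
    ContinuousOn (graphPullback p q X) (Icc α β ×ˢ Icc 0 1 ×ˢ T) := by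
  have hp' := hp.continuous_deriv one_le_two
  have hq' := hq.continuous_deriv one_le_two
  have hΦ := differentiable_graphChart (hp.differentiable two_ne_zero)
    (hq.differentiable two_ne_zero)
  have hXΦ := hX.comp hΦ.continuous.continuousOn (graphChart_mapsTo hpq)
  have hp := hp.continuous
  have hq := hq.continuous
  have width : Continuous (fun x : Coords => q x.1 - p x.1) := by fun_prop
  have slope : Continuous
      (fun x : Coords => deriv p x.1 + x.2.1 * (deriv q x.1 - deriv p x.1)) := by fun_prop
  exact (width.continuousOn.mul hXΦ.fst).prodMk ((hXΦ.snd.fst.sub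
    (slope.continuousOn.mul hXΦ.fst)).prodMk (width.continuousOn.smul hXΦ.snd.snd))

theorem divergence_graphPullback (hp : ContDiff ℝ 2 p) (hq : ContDiff ℝ 2 q) {x : Coords}
    (hX : DifferentiableAt ℝ X (graphChart p q x)) :
    divergence (graphPullback p q X) x = (q x.1 - p x.1) * divergence X (graphChart p q x) := by
  have dp := (hp.differentiable two_ne_zero x.1).hasDerivAt
  have dq := (hq.differentiable two_ne_zero x.1).hasDerivAt
  let pr₁ := ContinuousLinearMap.fst ℝ ℝ (ℝ × ℝ × ℝ)
  let pr₂ := (ContinuousLinearMap.fst ℝ ℝ (ℝ × ℝ)).comp (ContinuousLinearMap.snd ℝ ℝ (ℝ × ℝ × ℝ))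
  let prξ := (ContinuousLinearMap.snd ℝ ℝ (ℝ × ℝ)).comp (ContinuousLinearMap.snd ℝ ℝ (ℝ × ℝ × ℝ))
  have line (L : Coords →L[ℝ] ℝ) {γ : ℝ → Coords} {v : Coords} {t : ℝ} (hx : γ t = graphChart p q x)
      (hγ : HasDerivAt γ v t) :
      HasDerivAt (fun t => L (X (γ t))) (L (fderiv ℝ X (graphChart p q x) v)) t :=
    L.hasFDerivAt.comp_hasDerivAt t (hX.hasFDerivAt.comp_hasDerivAt_of_eq t hγ hx.symm)
  have const {E : Type} [NormedAddCommGroup E] [NormedSpace ℝ E] (t : ℝ) (c : E) :=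
    hasDerivAt_const t c
  have hτ := ((hasDerivAt_id x.2.1).mul_const (q x.1 - p x.1)).const_add (p x.1)
  have alongU := (hasDerivAt_id x.1).prodMk
    ((dp.add ((dq.sub dp).const_mul x.2.1)).prodMk (const x.1 x.2.2))
  have alongτ := (const x.2.1 x.1).prodMk (hτ.prodMk (const x.2.1 x.2.2))
  have alongθ := (const x.2.2.1 x.1).prodMk ((const x.2.2.1 (graphChart p q x).2.1).prodMk
    ((hasDerivAt_id x.2.2.1).prodMk (const x.2.2.1 x.2.2.2)))
  have alongφ := (const x.2.2.2 x.1).prodMk ((const x.2.2.2 (graphChart p q x).2.1).prodMk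
    ((const x.2.2.2 x.2.2.1).prodMk (hasDerivAt_id x.2.2.2)))
  rw [divergence_eq_of_hasDerivAt (differentiableAt_graphPullback hp hq hX)
    ((dq.sub dp).mul (line pr₁ rfl alongU))
    ((line pr₂ rfl alongτ).sub ((((hasDerivAt_id x.2.1).mul_const
      (deriv q x.1 - deriv p x.1)).const_add (deriv p x.1)).mul (line pr₁ rfl alongτ)))
    ((line ((ContinuousLinearMap.fst ℝ ℝ _).comp prξ) rfl alongθ).const_mul (q x.1 - p x.1))
    ((line ((ContinuousLinearMap.snd ℝ ℝ _).comp prξ) rfl alongφ).const_mul (q x.1 - p x.1))]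
  have split (L : Coords →L[ℝ] ℝ) (a r : ℝ) : L (fderiv ℝ X (graphChart p q x) (a, r, 0)) =
      a * L (fderiv ℝ X (graphChart p q x) (1, 0)) +
        r * L (fderiv ℝ X (graphChart p q x) (0, 1, 0)) := by
    simp only [← smul_eq_mul, ← map_smul, ← map_add]
    simp
  rw [split pr₁ 1, split pr₂ 0, split pr₁ 0 (1 * (q x.1 - p x.1))]
  simp only [divergence, pr₁, pr₂, prξ, ContinuousLinearMap.comp_apply,
    ContinuousLinearMap.coe_fst', ContinuousLinearMap.coe_snd', id, Pi.sub_apply, Prod.mk.eta]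
  ring

theorem Ioo_prod_ae_eq_Icc {E : Type*} [Preorder E] [MeasureSpace E]
    [SFinite (volume : Measure E)] (a b : ℝ) {c d : E} {S : Set E} (hS : S =ᵐ[volume] Icc c d) :
    (Ioo a b ×ˢ S : Set (ℝ × E)) =ᵐ[volume] Icc (a, c) (b, d) := by
  rw [Icc_prod_eq (a, c) (b, d)]
  exact Measure.set_prod_ae_eq Ioo_ae_eq_Icc hS

theorem le_on_Icc_of_lt_on_Ioo (hp : Continuous p) (hq : Continuous q) (hαβ : α < β)
    (hpq : ∀ u ∈ Ioo α β, p u < q u) {u : ℝ} (hu : u ∈ Icc α β) : p u ≤ q u :=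
  le_on_closure (fun v hv => (hpq v hv).le) hp.continuousOn hq.continuousOn
    (by rwa [closure_Ioo hαβ.ne])

theorem integrableOn_graphRegion_of_continuousOn (hp : Differentiable ℝ p)
    (hq : Differentiable ℝ q) (hαβ : α < β) (hpq : ∀ u ∈ Ioo α β, p u < q u)
    (hT : MeasurableSet T) {K : Set (ℝ × ℝ)} (hK : IsCompact K) (hTK : T ⊆ K) {f : Coords → ℝ}
    (hf : ContinuousOn f (closedGraphRegion p q α β K)) :
    IntegrableOn f (graphRegion p q α β T) := by
  have hpq' : ∀ u ∈ Icc α β, p u ≤ q u :=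
    fun _ => le_on_Icc_of_lt_on_Ioo hp.continuous hq.continuous hαβ hpq
  rw [integrableOn_graphRegion_iff hp hq hpq hT]
  have hc : ContinuousOn (fun x => (q x.1 - p x.1) * f (graphChart p q x))
      (Icc α β ×ˢ Icc 0 1 ×ˢ K) :=
    ((hq.continuous.comp continuous_fst).sub (hp.continuous.comp continuous_fst)).continuousOn.mul
      (hf.comp (differentiable_graphChart hp hq).continuous.continuousOn
        (graphChart_mapsTo hpq'))
  exact (hc.integrableOn_compact (isCompact_Icc.prod (isCompact_Icc.prod hK))).mono_set
    (prod_mono Ioo_subset_Icc_self (prod_mono Ioo_subset_Icc_self hTK))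

theorem HasBalancedSides.graphPullback {c d : ℝ × ℝ} (hs : HasBalancedSides X c d)
    (p q : ℝ → ℝ) : HasBalancedSides (graphPullback p q X) c d :=
  ⟨fun u _ φ => congrArg (fun z => (q u - p u) * z) (hs.polar u _ φ),
    fun u _ θ => congrArg (fun z => (q u - p u) * z) (hs.azimuthal u _ θ)⟩

theorem graphPullback_lower (p q : ℝ → ℝ) (X : Coords → Coords) (y : ℝ × ℝ × ℝ) :
    (graphPullback p q X (y.1, 0, y.2)).2.1 = -graphFlux X p y := by
  simp [graphPullback, graphChart, graphFlux]

theorem graphPullback_upper (p q : ℝ → ℝ) (X : Coords → Coords) (y : ℝ × ℝ × ℝ) :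
    (graphPullback p q X (y.1, 1, y.2)).2.1 = -graphFlux X q y := by
  simp [graphPullback, graphChart, graphFlux]

theorem setIntegral_graphPullback_fst {u : ℝ} (hpq : p u ≤ q u) (hT : MeasurableSet T) :
    ∫ y in Ioo 0 1 ×ˢ T, (graphPullback p q X (u, y)).1 =
      ∫ y in Ioo (p u) (q u) ×ˢ T, (X (u, y)).1 :=
  (setIntegral_Ioo_prod_eq_rescale hpq hT fun y => (X (u, y)).1).symm

theorem setIntegral_divergence_graphRegion (hp : ContDiff ℝ 2 p) (hq : ContDiff ℝ 2 q) (hαβ : α < β)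
    (hpq : ∀ u ∈ Ioo α β, p u < q u) {c d : ℝ × ℝ} (hcd : c ≤ d)
    (hT : T = Ioo c.1 d.1 ×ˢ Ioo c.2 d.2)
    (hX : ContinuousOn X (closedGraphRegion p q α β (Icc c d)))
    (hX' : ∀ x ∈ graphRegion p q α β T, DifferentiableAt ℝ X x)
    (hi : IntegrableOn (divergence X) (graphRegion p q α β T)) (hs : HasBalancedSides X c d) :
    ∫ x in graphRegion p q α β T, divergence X x =
      (∫ y in Ioo (p β) (q β) ×ˢ T, (X (β, y)).1) - (∫ y in Ioo (p α) (q α) ×ˢ T, (X (α, y)).1)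
        + ((∫ y in Ioo α β ×ˢ T, graphFlux X p y) - ∫ y in Ioo α β ×ˢ T, graphFlux X q y) := by
  have dp := hp.differentiable two_ne_zero
  have dq := hq.differentiable two_ne_zero
  have hpq' : ∀ u ∈ Icc α β, p u ≤ q u :=
    fun _ => le_on_Icc_of_lt_on_Ioo dp.continuous dq.continuous hαβ hpq
  have hTm : MeasurableSet T := hT ▸ measurableSet_Ioo.prod measurableSet_Ioo
  have hface (a b : ℝ) : (Ioo a b ×ˢ T : Set (ℝ × ℝ × ℝ)) =ᵐ[volume] Icc (a, c) (b, d) :=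
    Ioo_prod_ae_eq_Icc a b (hT ▸ Ioo_prod_ae_eq_Icc c.1 d.1 Ioo_ae_eq_Icc)
  have hbox : (Ioo α β ×ˢ Ioo 0 1 ×ˢ T : Set Coords) =ᵐ[volume] Icc (α, 0, c) (β, 1, d) :=
    Ioo_prod_ae_eq_Icc α β (hface 0 1)
  have hdiv : EqOn (fun x => (q x.1 - p x.1) * divergence X (graphChart p q x))
      (divergence (graphPullback p q X)) (Ioo α β ×ˢ Ioo 0 1 ×ˢ T) := fun x hx =>
    (divergence_graphPullback hp hq (hX' _ ((graphChart_bijOn hpq).mapsTo hx))).symm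
  have hbm : MeasurableSet (Ioo α β ×ˢ Ioo (0 : ℝ) 1 ×ˢ T) :=
    measurableSet_Ioo.prod (measurableSet_Ioo.prod hTm)
  rw [integrableOn_graphRegion_iff dp dq hpq hTm, integrableOn_congr_fun hdiv hbm,
    integrableOn_congr_set_ae hbox] at hi
  rw [setIntegral_graphRegion dp dq hpq hTm, setIntegral_congr_fun hbm hdiv,
    setIntegral_congr_set hbox, setIntegral_divergence_Icc ⟨hαβ.le, zero_le_one, hcd⟩ ?_ ?_ hi
      (hs.graphPullback p q)]
  · simp only [← setIntegral_congr_set (hface _ _), graphPullback_lower, graphPullback_upper,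
      integral_neg]
    rw [setIntegral_graphPullback_fst (hpq' β ⟨hαβ.le, le_rfl⟩) hTm,
      setIntegral_graphPullback_fst (hpq' α ⟨le_rfl, hαβ.le⟩) hTm, neg_sub_neg]
  · rw [Icc_prod_eq (α, (0 : ℝ), c), Icc_prod_eq ((0 : ℝ), c)]
    exact continuousOn_graphPullback hp hq hpq' hX
  · intro x hx
    simp only [Icc_prod_eq, interior_prod_eq, interior_Icc] at hx
    exact differentiableAt_graphPullback hp hq
      (hX' _ ((graphChart_bijOn hpq).mapsTo ⟨hx.1, hx.2.1, hT ▸ hx.2.2⟩))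

end GraphRegion

section Rays

variable {m : ℝ}

theorem tortoise_strictMonoOn (hm : 0 < m) : StrictMonoOn (tortoise m) (Ioi (2 * m)) := by
  intro a ha b _ hab
  have hlog : Real.log (a - 2 * m) < Real.log (b - 2 * m) :=
    Real.log_lt_log (sub_pos.2 ha) (sub_lt_sub_right hab _)
  unfold tortoise
  gcongr

theorem hasDerivAt_tortoise {r : ℝ} (hr : 2 * m < r) :
    HasDerivAt (tortoise m) (1 + 2 * m * (1 / (r - 2 * m))) r :=
  (hasDerivAt_id' r).add
    ((((hasDerivAt_id' r).sub_const (2 * m)).log (sub_pos.2 hr).ne').const_mul (2 * m))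

theorem lt_radius (hm : 0 < m) (x : ℝ) : 2 * m < radius m x :=
  Function.invFunOn_mem ((tortoise_bijOn hm).surjOn (mem_univ x))

theorem radius_pos (hm : 0 < m) (x : ℝ) : 0 < radius m x :=
  (mul_pos two_pos hm).trans (lt_radius hm x)

theorem tortoise_radius (hm : 0 < m) (x : ℝ) : tortoise m (radius m x) = x :=
  Function.invFunOn_eq ((tortoise_bijOn hm).surjOn (mem_univ x))

theorem radius_tortoise (hm : 0 < m) {r : ℝ} (hr : 2 * m < r) : radius m (tortoise m r) = r :=
  (tortoise_bijOn hm).injOn (lt_radius hm _) hr (tortoise_radius hm _)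

theorem radius_strictMono (hm : 0 < m) : StrictMono (radius m) := by
  intro x y hxy
  rwa [← (tortoise_strictMonoOn hm).lt_iff_lt (lt_radius hm x) (lt_radius hm y),
    tortoise_radius hm, tortoise_radius hm]

theorem radius_le_iff (hm : 0 < m) {x r : ℝ} (hr : 2 * m < r) :
    radius m x ≤ r ↔ x ≤ tortoise m r := by
  rw [← (tortoise_strictMonoOn hm).le_iff_le (lt_radius hm x) hr, tortoise_radius hm]

theorem radius_lt_iff (hm : 0 < m) {x r : ℝ} (hr : 2 * m < r) :
    radius m x < r ↔ x < tortoise m r := by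
  rw [← (tortoise_strictMonoOn hm).lt_iff_lt (lt_radius hm x) hr, tortoise_radius hm]

theorem continuous_radius (hm : 0 < m) : Continuous (radius m) := by
  let f : ℝ → Ioi (2 * m) := fun x => ⟨radius m x, lt_radius hm x⟩
  have hf : Continuous f := by
    refine Monotone.continuous_of_surjective (fun x y h => (radius_strictMono hm).monotone h) ?_
    rintro ⟨r, hr⟩
    exact ⟨tortoise m r, Subtype.ext (radius_tortoise hm hr)⟩
  exact continuous_subtype_val.comp hf

theorem hasDerivAt_radius (hm : 0 < m) (x : ℝ) :
    HasDerivAt (radius m) (lapse m (1 / radius m x)) x := by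
  have hr := sub_pos.2 (lt_radius hm x)
  have h0 := radius_pos hm x
  have hne : 1 + 2 * m * (1 / (radius m x - 2 * m)) ≠ 0 := by positivity
  refine (HasDerivAt.of_local_left_inverse (continuous_radius hm).continuousAt
    (hasDerivAt_tortoise (lt_radius hm x)) hne (.of_forall (tortoise_radius hm))).congr_deriv ?_
  rw [lapse]
  field_simp
  ring

theorem tendsto_radius_atTop (hm : 0 < m) :
    Filter.Tendsto (radius m) Filter.atTop Filter.atTop := by
  refine Filter.tendsto_atTop_atTop_of_monotone (radius_strictMono hm).monotone fun b => ?_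
  have hr : 2 * m < max b (2 * m + 1) := lt_max_of_lt_right (lt_add_one _)
  exact ⟨tortoise m (max b (2 * m + 1)), (radius_tortoise hm hr).symm ▸ le_max_left _ _⟩

theorem eventually_tortoise_le (hm : 0 < m) :
    ∀ᶠ r in Filter.atTop, tortoise m r ≤ 5 / 4 * r := by
  have hlog : ∀ᶠ r : ℝ in Filter.atTop, ‖Real.log r‖ ≤ 1 / (8 * m) * ‖r‖ :=
    Real.isLittleO_log_id_atTop.bound (by positivity)
  filter_upwards [hlog, Filter.eventually_gt_atTop (2 * m)] with r hr hmr
  have h0 : 0 < r := (mul_pos two_pos hm).trans hmr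
  rw [Real.norm_of_nonneg h0.le] at hr
  have hle : Real.log (r - 2 * m) ≤ 1 / (8 * m) * r :=
    (Real.log_le_log (sub_pos.2 hmr) (by linarith)).trans ((le_abs_self _).trans hr)
  calc tortoise m r ≤ r + 2 * m * (1 / (8 * m) * r) := by unfold tortoise; gcongr
    _ = 5 / 4 * r := by field_simp; norm_num

/-- The curve `R = p(u)` lies in the region `R ≥ 0` and moves along `r_* = const - σ u`, that is,
`p' = σ F p²`. -/
structure IsRay (m σ : ℝ) (p : ℝ → ℝ) : Prop where
  hasDerivAt : ∀ u, HasDerivAt p (σ * (lapse m (p u) * p u ^ 2)) u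
  nonneg : ∀ u, 0 ≤ p u

theorem IsRay.deriv_eq {σ : ℝ} {p : ℝ → ℝ} (hp : IsRay m σ p) (u : ℝ) :
    deriv p u = σ * (lapse m (p u) * p u ^ 2) :=
  (hp.hasDerivAt u).deriv

theorem IsRay.contDiff_two {σ : ℝ} {p : ℝ → ℝ} (hp : IsRay m σ p) : ContDiff ℝ 2 p := by
  have hd : Differentiable ℝ p := fun u => (hp.hasDerivAt u).differentiableAt
  have hp' : deriv p = fun u => σ * (lapse m (p u) * p u ^ 2) := funext hp.deriv_eq
  have hc1 : ContDiff ℝ 1 p := by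
    refine contDiff_one_iff_deriv.2 ⟨hd, ?_⟩
    rw [hp']
    unfold lapse
    have := hd.continuous
    fun_prop
  refine (contDiff_succ_iff_deriv (n := 1)).2 ⟨hd, by simp, ?_⟩
  rw [hp']
  unfold lapse
  fun_prop

/-- The value of `R` at retarded time `u` on the hypersurface `r_* = c - σ u`. -/
def lineR (m c σ u : ℝ) : ℝ := 1 / radius m (c - σ * u)

theorem lineR_pos (hm : 0 < m) (c σ u : ℝ) : 0 < lineR m c σ u :=
  one_div_pos.2 (radius_pos hm _)

theorem isRay_lineR (hm : 0 < m) (c σ : ℝ) : IsRay m σ (lineR m c σ) := by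
  refine ⟨fun u => ?_, fun u => (lineR_pos hm c σ u).le⟩
  have hline : HasDerivAt (fun v => c - σ * v) (-σ) u := by
    simpa using ((hasDerivAt_id' u).const_mul σ).const_sub c
  have hcomp : HasDerivAt (fun v => radius m (c - σ * v))
      (lapse m (1 / radius m (c - σ * u)) * -σ) u := (hasDerivAt_radius hm _).comp u hline
  have heq : lineR m c σ = (fun v => radius m (c - σ * v))⁻¹ := by
    ext v
    simp [lineR]
  rw [heq]
  refine (hcomp.inv (radius_pos hm _).ne').congr_deriv ?_
  simp only [Pi.inv_apply, one_div]
  ring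

theorem lineR_lt_lineR_iff (hm : 0 < m) {c σ c' σ' u : ℝ} :
    lineR m c σ u < lineR m c' σ' u ↔ c' - σ' * u < c - σ * u := by
  rw [lineR, lineR, one_div_lt_one_div (radius_pos hm _) (radius_pos hm _),
    (radius_strictMono hm).lt_iff_lt]

theorem exists_lineR_eq (hm : 0 < m) {R : ℝ} (hR : 0 < R) (hmR : 2 * m * R < 1) (σ u : ℝ) :
    ∃ c, lineR m c σ u = R :=
  ⟨tortoise m (1 / R) + σ * u, by
    rw [lineR, add_sub_cancel_right, radius_tortoise hm ((lt_div_iff₀ hR).2 hmR), one_div_one_div]⟩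

theorem hypR_eq_lineR (m : ℝ) {s : ℝ} (hs : s ≠ 0) : hypR m s = lineR m 0 (1 / s) := by
  ext u
  rw [hypR, if_neg hs, lineR]
  congr 2
  ring

theorem hypR_zero (m : ℝ) : hypR m 0 = 0 := by
  ext u
  simp [hypR]

theorem hypR_one (m : ℝ) : hypR m 1 = lineR m 0 1 := by
  rw [hypR_eq_lineR m one_ne_zero, one_div_one]

theorem two_mul_hypR_one_lt (hm : 0 < m) (u : ℝ) : 2 * m * hypR m 1 u < 1 := by
  rw [hypR_one, lineR, mul_one_div, div_lt_one (radius_pos hm _)]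
  exact lt_radius hm _

theorem hypR_lt_hypR_one (hm : 0 < m) {s u : ℝ} (h0 : 0 ≤ s) (h1 : s < 1) (hu : u < 0) :
    hypR m s u < hypR m 1 u := by
  rw [hypR_one]
  rcases h0.eq_or_lt with rfl | hs
  · rw [hypR_zero]
    exact lineR_pos hm 0 1 u
  · rw [hypR_eq_lineR m hs.ne']
    have : 1 < 1 / s := (one_lt_div hs).2 h1
    exact (lineR_lt_lineR_iff hm).2 (by nlinarith)

/-- The slope `- dr_* / du` of `H_s`; any value would do on `H_0`, where `R = 0`. -/
def hypSlope (s : ℝ) : ℝ := if s = 0 then 1 else 1 / s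

theorem one_le_hypSlope {s : ℝ} (h0 : 0 ≤ s) (h1 : s ≤ 1) : 1 ≤ hypSlope s := by
  rw [hypSlope]
  split_ifs with h
  · exact le_rfl
  · exact one_le_one_div (h0.lt_of_ne' h) h1

theorem isRay_hypR (hm : 0 < m) (s : ℝ) : IsRay m (hypSlope s) (hypR m s) := by
  rcases eq_or_ne s 0 with rfl | hs
  · rw [hypR_zero]
    exact ⟨fun u => by simp [Pi.zero_def, hasDerivAt_const], fun _ => le_rfl⟩
  · rw [hypR_eq_lineR m hs, hypSlope, if_neg hs]
    exact isRay_lineR hm 0 (1 / s)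

theorem mem_domain (hm : 0 < m) {u₀ u R : ℝ} (hu : u ≤ u₀) (hR : R ∈ Icc 0 (hypR m 1 u)) :
    (u, R) ∈ domain m u₀ := by
  refine ⟨hu, hR.1.eq_or_lt.imp Eq.symm fun h0 => ?_⟩
  have hmR : 2 * m * R < 1 := lt_of_le_of_lt (by gcongr; exact hR.2) (two_mul_hypR_one_lt hm u)
  rw [hypR_one, lineR] at hR
  have := (radius_le_iff hm ((lt_div_iff₀ h0).2 hmR)).1
    ((le_one_div (radius_pos hm (0 - 1 * u)) h0).2 hR.2)
  exact ⟨h0, hmR, by dsimp only; linarith⟩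

theorem mem_domainInterior (hm : 0 < m) {u₀ u R : ℝ} (hu : u < u₀) (hR : R ∈ Ioo 0 (hypR m 1 u)) :
    (u, R) ∈ domainInterior m u₀ := by
  have hmR : 2 * m * R < 1 := lt_of_lt_of_le (by gcongr; exact hR.2) (two_mul_hypR_one_lt hm u).le
  rw [hypR_one, lineR] at hR
  have := (radius_lt_iff hm ((lt_div_iff₀ hR.1).2 hmR)).1
    ((lt_one_div (radius_pos hm (0 - 1 * u)) hR.1).2 hR.2)
  exact ⟨hu, hR.1, hmR, by dsimp only; linarith⟩

/-- The part of the exterior in which the estimates hold: `u R` is not far below `-1`, its limit at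
spacelike infinity along `{t = 0}`, and `m R` is small. -/
structure InFarZone (m u R : ℝ) : Prop where
  neg : u < 0
  nonneg : 0 ≤ R
  mul_ge : -(5 / 4) ≤ u * R
  mass_le : 8 * m * R ≤ 1

/-- The future of `{t = 0}` in `{u ≤ u₀}` is contained in the far zone. -/
def IsFar (m u₀ : ℝ) : Prop := ∀ u ≤ u₀, ∀ R ∈ Icc 0 (hypR m 1 u), InFarZone m u R

theorem eventually_isFar (hm : 0 < m) : ∀ᶠ u₀ in Filter.atBot, IsFar m u₀ := by
  have htop := tendsto_radius_atTop hm
  have hfar : ∀ᶠ x in Filter.atTop, 0 < x ∧ x ≤ 5 / 4 * radius m x ∧ 8 * m ≤ radius m x := by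
    filter_upwards [Filter.eventually_gt_atTop 0, htop.eventually (eventually_tortoise_le hm),
      htop.eventually_ge_atTop (8 * m)] with x h0 hx hm8
    rw [tortoise_radius hm] at hx
    exact ⟨h0, hx, hm8⟩
  obtain ⟨M, hM⟩ := Filter.eventually_atTop.1 hfar
  filter_upwards [Filter.eventually_le_atBot (-M)] with u₀ hu₀ u hu R hR
  obtain ⟨h0, hur, hmr⟩ := hM (-u) (by linarith)
  have hr := radius_pos hm (-u)
  have hRr : R * radius m (-u) ≤ 1 := by
    rw [← le_div_iff₀ hr]
    simpa [hypR] using hR.2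
  have h1 := mul_le_mul_of_nonneg_left hur hR.1
  have h2 := mul_le_mul_of_nonneg_left hmr hR.1
  exact ⟨by linarith, hR.1, by linarith, by linarith⟩

end Rays

section Regularity

variable {m u₀ : ℝ} {B : BilinField} {x : Coords}

/-- The coordinates of the points of `Ω⁺_{u₀}`. -/
def fieldDomain (m u₀ : ℝ) : Set Coords := {x | (x.1, x.2.1) ∈ domain m u₀}

/-- The components `φ₀, φ₁, φ₂` of the field. -/
def phi (m : ℝ) (B : BilinField) : Fin 3 → Comp := ![phi0 m B, phi1 m B, phi2 m B]

/-- The components of the field as functions of the coordinates. -/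
def component (m : ℝ) (B : BilinField) (j : Fin 3) (x : Coords) : ℂ :=
  phi m B j x.1 x.2.1 x.2.2.1 x.2.2.2

theorem lapse_pos_of_mem_domain {q : ℝ × ℝ} (hq : q ∈ domain m u₀) : 0 < lapse m q.2 := by
  rcases hq.2 with h | h
  · simp [lapse, h]
  · exact sub_pos.2 h.2.1

theorem domainInterior_subset_domain (m u₀ : ℝ) : domainInterior m u₀ ⊆ domain m u₀ :=
  fun _ h => ⟨h.1.le, Or.inr ⟨h.2.1, h.2.2.1, h.2.2.2.le⟩⟩

theorem contDiff_lapse : ContDiff ℝ 1 fun x : Coords => lapse m x.2.1 := by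
  unfold lapse
  fun_prop

theorem contMDiff_spherePt :
    ContMDiff 𝓘(ℝ, Coords) (𝓡 2) ∞ fun x : Coords => spherePt x.2.2.1 x.2.2.2 := by
  refine ContMDiff.codRestrict_sphere (ContDiff.contMDiff (contDiff_euclidean.2 fun i => ?_)) _
  fin_cases i <;>
    simp only [Fin.zero_eta, Fin.mk_one, Fin.reduceFinMk, Fin.isValue,
      Matrix.cons_val_zero, Matrix.cons_val_one, Matrix.cons_val] <;>
    fun_prop

theorem contDiffOn_field (hB : IsMaxwellField m u₀ B) :
    ContDiffOn ℝ 1 (fun x : Coords => B (x.1, x.2.1, spherePt x.2.2.1 x.2.2.2))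
      (fieldDomain m u₀) := by
  have hu : ContMDiff 𝓘(ℝ, Coords) 𝓘(ℝ, ℝ) ∞ fun x : Coords => x.1 := contDiff_fst.contMDiff
  have hR : ContMDiff 𝓘(ℝ, Coords) 𝓘(ℝ, ℝ) ∞ fun x : Coords => x.2.1 :=
    contDiff_snd.fst.contMDiff
  have h := hB.smooth.comp (s := fieldDomain m u₀)
    (hu.prodMk (hR.prodMk contMDiff_spherePt)).contMDiffOn fun _ hx => hx
  exact (contMDiffOn_iff_contDiffOn.1 h).of_le (by exact_mod_cast le_top)

theorem contDiffWithinAt_cval {b : Coords → Vec →L[ℝ] Vec →L[ℝ] ℝ} {X Y : Coords → Vec × Vec}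
    {s : Set Coords} (hb : ContDiffWithinAt ℝ 1 b s x) (hX : ContDiffWithinAt ℝ 1 X s x)
    (hY : ContDiffWithinAt ℝ 1 Y s x) :
    ContDiffWithinAt ℝ 1 (fun x => cval (b x) (X x) (Y x)) s x := by
  have hre := ((hb.clm_apply hX.fst).clm_apply hY.fst).sub ((hb.clm_apply hX.snd).clm_apply hY.snd)
  have him := ((hb.clm_apply hX.fst).clm_apply hY.snd).add ((hb.clm_apply hX.snd).clm_apply hY.fst)
  exact Complex.equivRealProdCLM.symm.contDiff.comp_contDiffWithinAt (hre.prodMk him)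

theorem contDiff_eTheta : ContDiff ℝ 1 fun x : Coords => eTheta x.2.2.1 x.2.2.2 := by
  refine contDiff_euclidean.2 fun i => ?_
  fin_cases i <;>
    simp only [eTheta, Fin.zero_eta, Fin.mk_one, Fin.reduceFinMk, Fin.isValue,
      Matrix.cons_val_zero, Matrix.cons_val_one, Matrix.cons_val] <;>
    fun_prop

theorem contDiff_ePhi : ContDiff ℝ 1 fun x : Coords => ePhi x.2.2.2 := by
  refine contDiff_euclidean.2 fun i => ?_
  fin_cases i <;>
    simp only [ePhi, Fin.zero_eta, Fin.mk_one, Fin.reduceFinMk, Fin.isValue,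
      Matrix.cons_val_zero, Matrix.cons_val_one, Matrix.cons_val] <;>
    fun_prop

theorem contDiff_tetM : ContDiff ℝ 1 fun x : Coords => tetM x.2.2.1 x.2.2.2 := by
  have hθ := contDiff_eTheta
  have hφ := contDiff_ePhi
  unfold tetM
  fun_prop

theorem contDiff_tetMbar : ContDiff ℝ 1 fun x : Coords => tetMbar x.2.2.1 x.2.2.2 := by
  have hθ := contDiff_eTheta
  have hφ := contDiff_ePhi
  unfold tetMbar
  fun_prop

theorem contDiffAt_tetL (hx : 0 < lapse m x.2.1) :
    ContDiffAt ℝ 1 (fun x : Coords => tetL m x.2.1) x := by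
  have h := (contDiff_lapse.contDiffAt.div_const 2).sqrt (half_pos hx).ne'
  unfold tetL
  fun_prop

theorem contDiffAt_tetN (hx : 0 < lapse m x.2.1) :
    ContDiffAt ℝ 1 (fun x : Coords => tetN m x.2.1) x := by
  have hF : ContDiffAt ℝ 1 (fun x : Coords => lapse m x.2.1) x := contDiff_lapse.contDiffAt
  have h := (contDiffAt_const (c := (2 : ℝ)).div hF hx.ne').sqrt (div_pos two_pos hx).ne'
  unfold tetN
  fun_prop

theorem contDiffOn_component (hB : IsMaxwellField m u₀ B) (j : Fin 3) :
    ContDiffOn ℝ 1 (component m B j) (fieldDomain m u₀) := by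
  intro x hx
  have hb := contDiffOn_field hB x hx
  have hF : 0 < lapse m x.2.1 := lapse_pos_of_mem_domain hx
  have hl := (contDiffAt_tetL hF).contDiffWithinAt (s := fieldDomain m u₀)
  have hn := (contDiffAt_tetN hF).contDiffWithinAt (s := fieldDomain m u₀)
  have hm := contDiff_tetM.contDiffWithinAt (s := fieldDomain m u₀) (x := x)
  have hm' := contDiff_tetMbar.contDiffWithinAt (s := fieldDomain m u₀) (x := x)
  fin_cases j
  · exact contDiffWithinAt_cval hb hl hm
  · exact ((contDiffWithinAt_cval hb hl hn).add (contDiffWithinAt_cval hb hm' hm)).div_const 2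
  · exact contDiffWithinAt_cval hb hm' hn

theorem fieldDomain_mem_nhds (hx : (x.1, x.2.1) ∈ domainInterior m u₀) :
    fieldDomain m u₀ ∈ nhds x := by
  obtain ⟨hu, hR, hmR, ht⟩ := hx
  have cu : ContinuousAt (fun y : Coords => y.1) x := continuousAt_fst
  have cR : ContinuousAt (fun y : Coords => y.2.1) x := continuousAt_snd.fst
  have ct : ContinuousAt (fun y : Coords => tortoise m (1 / y.2.1)) x :=
    ContinuousAt.comp' (g := tortoise m) (hasDerivAt_tortoise ((lt_div_iff₀ hR).2 hmR)).continuousAt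
      (continuousAt_const.div cR hR.ne')
  filter_upwards [cu.eventually_lt continuousAt_const hu, continuousAt_const.eventually_lt cR hR,
    (continuousAt_const.mul cR).eventually_lt continuousAt_const hmR,
    continuousAt_const.eventually_lt (cu.add ct) ht] with y hyu hyR hymR hyt
  exact domainInterior_subset_domain m u₀ ⟨hyu, hyR, hymR, hyt⟩

theorem differentiableAt_component (hB : IsMaxwellField m u₀ B) (j : Fin 3)
    (hx : (x.1, x.2.1) ∈ domainInterior m u₀) : DifferentiableAt ℝ (component m B j) x :=
  (((contDiffOn_component hB j).contDiffAt (fieldDomain_mem_nhds hx)).differentiableAt one_ne_zero)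

theorem component_two_pi (m : ℝ) (B : BilinField) (j : Fin 3) (u R θ : ℝ) :
    component m B j (u, R, θ, 2 * Real.pi) = component m B j (u, R, θ, 0) := by
  fin_cases j <;> simp [component, phi, phi0, phi1, phi2, spherePt, tetM, tetMbar, eTheta, ePhi]

end Regularity

section MaxwellJet

/-- The components of a field at a point, together with their derivatives along `∂_u`, `∂_R`, `∂_θ`
and `∂_φ` there. -/
structure Jet where
  (val du dR dθ dφ : Fin 3 → ℂ)

/-- The jet of the field `B` at `x`. -/
def jet (m : ℝ) (B : BilinField) (x : Coords) : Jet where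
  val j := component m B j x
  du j := dU (phi m B j) x.1 x.2.1 x.2.2.1 x.2.2.2
  dR j := MaxwellPeeling.dR (phi m B j) x.1 x.2.1 x.2.2.1 x.2.2.2
  dθ j := dTheta (phi m B j) x.1 x.2.1 x.2.2.1 x.2.2.2
  dφ j := dPhi (phi m B j) x.1 x.2.1 x.2.2.1 x.2.2.2

/-- The Maxwell equations at a point, cleared of denominators; `k` stands for `√F`, `s` and `c` for
the sine and the cosine of the polar angle. -/
structure Jet.IsMaxwell (J : Jet) (m R k s c : ℝ) : Prop where
  eq1 : s * (J.du 0 + R ^ 2 * k ^ 2 / 2 * J.dR 0) - k / 2 * (s * J.dθ 1 + Complex.I * J.dφ 1)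
    - s * (5 * m * R ^ 2 - 2 * R) / 2 * J.val 0 = 0
  eq2 : s * k * J.dR 1 + (s * J.dθ 0 - Complex.I * J.dφ 0 + c * J.val 0) = 0
  eq3 : s * (J.du 1 + R ^ 2 * k ^ 2 / 2 * J.dR 1)
    - k / 2 * (s * J.dθ 2 + Complex.I * J.dφ 2 + c * J.val 2) = 0
  eq4 : s * k ^ 2 * J.dR 2 + k * (s * J.dθ 1 - Complex.I * J.dφ 1) - s * m * J.val 2 = 0

theorem isMaxwell_jet {m u₀ : ℝ} {B : BilinField} {x : Coords} (hB : IsMaxwellField m u₀ B)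
    (hx : (x.1, x.2.1) ∈ domainInterior m u₀) (hθ : x.2.2.1 ∈ Ioo 0 Real.pi) :
    (jet m B x).IsMaxwell m x.2.1 √(lapse m x.2.1) (Real.sin x.2.2.1) (Real.cos x.2.2.1) := by
  have hF : 0 < lapse m x.2.1 := lapse_pos_of_mem_domain (domainInterior_subset_domain m u₀ hx)
  have r1 : √(lapse m x.2.1 / 2) = √(lapse m x.2.1) / √2 := Real.sqrt_div hF.le 2
  have r2 : √(2 / lapse m x.2.1) = √2 / √(lapse m x.2.1) := Real.sqrt_div zero_le_two _
  have r3 : √(2 * lapse m x.2.1) = √2 * √(lapse m x.2.1) := Real.sqrt_mul zero_le_two _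
  have hq : ((√2 : ℝ) : ℂ) ^ 2 = 2 := by
    rw [← Complex.ofReal_pow, Real.sq_sqrt zero_le_two, Complex.ofReal_ofNat]
  have hk : (√(lapse m x.2.1) : ℂ) ≠ 0 := by exact_mod_cast (Real.sqrt_pos.2 hF).ne'
  have hk2 : (lapse m x.2.1 : ℂ) = √(lapse m x.2.1) ^ 2 := by
    exact_mod_cast (Real.sq_sqrt hF.le).symm
  have hs : (Real.sin x.2.2.1 : ℂ) ≠ 0 := by exact_mod_cast (Real.sin_pos_of_mem_Ioo hθ).ne'
  have e1 := hB.eq1 _ _ _ x.2.2.2 hx hθ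
  have e2 := hB.eq2 _ _ _ x.2.2.2 hx hθ
  have e3 := hB.eq3 _ _ _ x.2.2.2 hx hθ
  have e4 := hB.eq4 _ _ _ x.2.2.2 hx hθ
  rw [show phi0 m B = phi m B 0 from rfl, show phi1 m B = phi m B 1 from rfl] at e1 e2
  rw [show phi1 m B = phi m B 1 from rfl, show phi2 m B = phi m B 2 from rfl] at e3 e4
  simp only [opD', opD, opDelta, opDelta', spinGamma, spinBeta, spinEps, r1, r2, r3] at e1 e2 e3 e4
  generalize Real.sin x.2.2.1 = s at hs e1 e2 e3 e4 ⊢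
  generalize Real.cos x.2.2.1 = c at e1 e2 e3 e4 ⊢
  push_cast [hk2] at e1 e2 e3 e4
  field_simp at e1 e2 e3 e4
  rw [hq] at e1 e3
  constructor <;> simp only [jet, component]
  · linear_combination e1 / 4
  · linear_combination -e2
  · linear_combination e3 / 4
  · linear_combination -e4

end MaxwellJet

section Current

open scoped ComplexConjugate

variable {m u₀ : ℝ} {B : BilinField} {x : Coords}

/-- The coefficient `2 + 2uR + (uR)² F / 2`, which is `√(F / 2)` times the component of the Morawetz
vector field along `l`. -/
def morawetzG (m u R : ℝ) : ℝ := 2 + 2 * (u * R) + (u * R) ^ 2 * lapse m R / 2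

/-- The component `V^u` of the Morawetz current, as a function of the coordinates. -/
def fluxU (m : ℝ) (B : BilinField) (x : Coords) : ℝ :=
  2 / lapse m x.2.1 * morawetzG m x.1 x.2.1 * ‖component m B 0 x‖ ^ 2
    + x.1 ^ 2 * ‖component m B 1 x‖ ^ 2

/-- The component `V^R` of the Morawetz current, as a function of the coordinates. -/
def fluxR (m : ℝ) (B : BilinField) (x : Coords) : ℝ :=
  x.2.1 ^ 2 * morawetzG m x.1 x.2.1 * ‖component m B 0 x‖ ^ 2
    - (2 + 2 * (x.1 * x.2.1)) * ‖component m B 1 x‖ ^ 2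
    - x.1 ^ 2 * (lapse m x.2.1 / 2) * ‖component m B 2 x‖ ^ 2

/-- The angular part of the Morawetz current, as the complex number `-V^θ + i sin θ V^φ`. -/
def fluxAngular (m : ℝ) (B : BilinField) (x : Coords) : ℂ :=
  (2 * morawetzG m x.1 x.2.1 / √(lapse m x.2.1)) • (conj (component m B 0 x) * component m B 1 x)
    + (x.1 ^ 2 * √(lapse m x.2.1)) • (conj (component m B 1 x) * component m B 2 x)

/-- The Morawetz current as a vector density in the coordinates `(u, R, θ, φ)`, that is, multiplied
by `sin θ`. -/
def currentDensity (m : ℝ) (B : BilinField) (x : Coords) : Coords :=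
  (Real.sin x.2.2.1 * fluxU m B x, Real.sin x.2.2.1 * fluxR m B x,
    -(Real.sin x.2.2.1 * (fluxAngular m B x).re), (fluxAngular m B x).im)

theorem contDiff_morawetzG : ContDiff ℝ 1 fun x : Coords => morawetzG m x.1 x.2.1 := by
  unfold morawetzG lapse
  fun_prop

theorem contDiffOn_currentDensity (hB : IsMaxwellField m u₀ B) :
    ContDiffOn ℝ 1 (currentDensity m B) (fieldDomain m u₀) := by
  have hφ := contDiffOn_component hB
  have hn (j : Fin 3) := (hφ j).norm_sq ℝ
  have hc (j : Fin 3) : ContDiffOn ℝ 1 (fun x => conj (component m B j x)) (fieldDomain m u₀) :=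
    Complex.conjCLE.contDiff.comp_contDiffOn (hφ j)
  have hG := (contDiff_morawetzG (m := m)).contDiffOn (s := fieldDomain m u₀)
  have hF := (contDiff_lapse (m := m)).contDiffOn (s := fieldDomain m u₀)
  have hF0 (x : Coords) (hx : x ∈ fieldDomain m u₀) : 0 < lapse m x.2.1 :=
    lapse_pos_of_mem_domain hx
  have hk : ContDiffOn ℝ 1 (fun x : Coords => √(lapse m x.2.1)) (fieldDomain m u₀) :=
    hF.sqrt fun x hx => (hF0 x hx).ne'
  have hU : ContDiffOn ℝ 1 (fluxU m B) (fieldDomain m u₀) :=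
    (((contDiffOn_const.div hF fun x hx => (hF0 x hx).ne').mul hG).mul (hn 0)).add
      ((contDiffOn_fst.pow 2).mul (hn 1))
  have hR : ContDiffOn ℝ 1 (fluxR m B) (fieldDomain m u₀) := by
    unfold fluxR
    fun_prop
  have hA : ContDiffOn ℝ 1 (fluxAngular m B) (fieldDomain m u₀) :=
    (((contDiffOn_const.mul hG).div hk fun x hx => (Real.sqrt_pos.2 (hF0 x hx)).ne').smul
      ((hc 0).mul (hφ 1))).add (((contDiffOn_fst.pow 2).mul hk).smul ((hc 1).mul (hφ 2)))
  have hs : ContDiff ℝ 1 fun x : Coords => Real.sin x.2.2.1 := by fun_prop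
  exact (hs.contDiffOn.mul hU).prodMk ((hs.contDiffOn.mul hR).prodMk
    ((hs.contDiffOn.mul (Complex.reCLM.contDiff.comp_contDiffOn hA)).neg.prodMk
      (Complex.imCLM.contDiff.comp_contDiffOn hA)))

theorem differentiableAt_currentDensity (hB : IsMaxwellField m u₀ B)
    (hx : (x.1, x.2.1) ∈ domainInterior m u₀) : DifferentiableAt ℝ (currentDensity m B) x :=
  ((contDiffOn_currentDensity hB).contDiffAt (fieldDomain_mem_nhds hx)).differentiableAt one_ne_zero

theorem hasBalancedSides_currentDensity (m : ℝ) (B : BilinField) :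
    HasBalancedSides (currentDensity m B) (0, 0) (Real.pi, 2 * Real.pi) where
  polar u R φ := by simp [currentDensity]
  azimuthal u R θ := by simp [currentDensity, fluxAngular, component_two_pi]

theorem hasDerivAt_lapse (m R : ℝ) : HasDerivAt (lapse m) (-(2 * m)) R :=
  (((hasDerivAt_id' R).const_mul (2 * m)).const_sub 1).congr_deriv (by ring)

theorem hasDerivAt_morawetzG_u (m u R : ℝ) :
    HasDerivAt (fun u => morawetzG m u R) (2 * R + u * R ^ 2 * lapse m R) u := by
  have h := (hasDerivAt_id' u).mul_const R
  refine (((h.const_mul 2).const_add 2).add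
    (((h.pow 2).mul_const (lapse m R)).div_const 2)).congr_deriv ?_
  push_cast
  ring

theorem hasDerivAt_morawetzG_R (m u R : ℝ) :
    HasDerivAt (morawetzG m u) (2 * u + u ^ 2 * R * lapse m R - m * (u * R) ^ 2) R := by
  have h := (hasDerivAt_id' R).const_mul u
  refine (((h.const_mul 2).const_add 2).add
    (((h.pow 2).mul (hasDerivAt_lapse m R)).div_const 2)).congr_deriv ?_
  simp only [Pi.pow_apply]
  push_cast
  ring

theorem hasDerivAt_component_u (hB : IsMaxwellField m u₀ B)
    (hx : (x.1, x.2.1) ∈ domainInterior m u₀) (j : Fin 3) :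
    HasDerivAt (fun t => component m B j (t, x.2)) ((jet m B x).du j) x.1 :=
  (hasDerivAt_slice_u (differentiableAt_component hB j hx)).differentiableAt.hasDerivAt

theorem hasDerivAt_component_R (hB : IsMaxwellField m u₀ B)
    (hx : (x.1, x.2.1) ∈ domainInterior m u₀) (j : Fin 3) :
    HasDerivAt (fun t => component m B j (x.1, t, x.2.2)) ((jet m B x).dR j) x.2.1 :=
  (hasDerivAt_slice_R (differentiableAt_component hB j hx)).differentiableAt.hasDerivAt

theorem hasDerivAt_component_theta (hB : IsMaxwellField m u₀ B)
    (hx : (x.1, x.2.1) ∈ domainInterior m u₀) (j : Fin 3) :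
    HasDerivAt (fun t => component m B j (x.1, x.2.1, t, x.2.2.2)) ((jet m B x).dθ j) x.2.2.1 :=
  (hasDerivAt_slice_theta (differentiableAt_component hB j hx)).differentiableAt.hasDerivAt

theorem hasDerivAt_component_phi (hB : IsMaxwellField m u₀ B)
    (hx : (x.1, x.2.1) ∈ domainInterior m u₀) (j : Fin 3) :
    HasDerivAt (fun t => component m B j (x.1, x.2.1, x.2.2.1, t)) ((jet m B x).dφ j) x.2.2.2 :=
  (hasDerivAt_slice_phi (differentiableAt_component hB j hx)).differentiableAt.hasDerivAt

theorem hasDerivAt_fluxU (hB : IsMaxwellField m u₀ B) (hx : (x.1, x.2.1) ∈ domainInterior m u₀) :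
    HasDerivAt (fun t => fluxU m B (t, x.2))
      (2 / lapse m x.2.1 * ((2 * x.2.1 + x.1 * x.2.1 ^ 2 * lapse m x.2.1)
          * ‖(jet m B x).val 0‖ ^ 2
        + morawetzG m x.1 x.2.1 * (2 * inner ℝ ((jet m B x).val 0) ((jet m B x).du 0)))
      + (2 * x.1 * ‖(jet m B x).val 1‖ ^ 2
        + x.1 ^ 2 * (2 * inner ℝ ((jet m B x).val 1) ((jet m B x).du 1)))) x.1 := by
  have hφ (j : Fin 3) := (hasDerivAt_component_u hB hx j).norm_sq
  refine ((((hasDerivAt_morawetzG_u m x.1 x.2.1).const_mul (2 / lapse m x.2.1)).mul (hφ 0)).add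
    (((hasDerivAt_id' x.1).pow 2).mul (hφ 1))).congr_deriv ?_
  simp only [jet, Pi.pow_apply]
  push_cast
  ring

theorem hasDerivAt_fluxR (hB : IsMaxwellField m u₀ B) (hx : (x.1, x.2.1) ∈ domainInterior m u₀) :
    HasDerivAt (fun t => fluxR m B (x.1, t, x.2.2))
      ((2 * x.2.1 * morawetzG m x.1 x.2.1
          + x.2.1 ^ 2 * (2 * x.1 + x.1 ^ 2 * x.2.1 * lapse m x.2.1 - m * (x.1 * x.2.1) ^ 2))
          * ‖(jet m B x).val 0‖ ^ 2
        + x.2.1 ^ 2 * morawetzG m x.1 x.2.1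
          * (2 * inner ℝ ((jet m B x).val 0) ((jet m B x).dR 0))
      - (2 * x.1 * ‖(jet m B x).val 1‖ ^ 2
        + (2 + 2 * (x.1 * x.2.1)) * (2 * inner ℝ ((jet m B x).val 1) ((jet m B x).dR 1)))
      - x.1 ^ 2 * (lapse m x.2.1 / 2 * (2 * inner ℝ ((jet m B x).val 2) ((jet m B x).dR 2))
        - m * ‖(jet m B x).val 2‖ ^ 2)) x.2.1 := by
  have hφ (j : Fin 3) := (hasDerivAt_component_R hB hx j).norm_sq
  have hR := hasDerivAt_id' x.2.1
  refine (((((hR.pow 2).mul (hasDerivAt_morawetzG_R m x.1 x.2.1)).mul (hφ 0)).sub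
    ((((hR.const_mul x.1).const_mul 2).const_add 2).mul (hφ 1))).sub
      ((((hasDerivAt_lapse m x.2.1).div_const 2).const_mul (x.1 ^ 2)).mul (hφ 2))).congr_deriv ?_
  simp only [jet, Pi.mul_apply, Pi.pow_apply]
  push_cast
  ring

theorem hasDerivAt_smul_conj_mul_add {f : Fin 3 → ℝ → ℂ} {f' : Fin 3 → ℂ} {t a b : ℝ}
    (hf : ∀ j, HasDerivAt (f j) (f' j) t) :
    HasDerivAt (fun t => a • (conj (f 0 t) * f 1 t) + b • (conj (f 1 t) * f 2 t))
      (a • (conj (f' 0) * f 1 t + conj (f 0 t) * f' 1)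
        + b • (conj (f' 1) * f 2 t + conj (f 1 t) * f' 2)) t :=
  (((hf 0).star.mul (hf 1)).const_smul a).add (((hf 1).star.mul (hf 2)).const_smul b)

-- The left-hand side is the divergence of `currentDensity`, expanded by the product rule.
theorem Jet.IsMaxwell.divergence_eq {J : Jet} {R k s c : ℝ} (hJ : J.IsMaxwell m R k s c)
    (hR : R ≠ 0) (hk : k ≠ 0) (hkF : lapse m R = k ^ 2) (u : ℝ) :
    s * (2 / lapse m R * ((2 * R + u * R ^ 2 * lapse m R) * ‖J.val 0‖ ^ 2
          + morawetzG m u R * (2 * inner ℝ (J.val 0) (J.du 0)))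
        + (2 * u * ‖J.val 1‖ ^ 2 + u ^ 2 * (2 * inner ℝ (J.val 1) (J.du 1))))
      + s * ((2 * R * morawetzG m u R
            + R ^ 2 * (2 * u + u ^ 2 * R * lapse m R - m * (u * R) ^ 2)) * ‖J.val 0‖ ^ 2
          + R ^ 2 * morawetzG m u R * (2 * inner ℝ (J.val 0) (J.dR 0))
        - (2 * u * ‖J.val 1‖ ^ 2 + (2 + 2 * (u * R)) * (2 * inner ℝ (J.val 1) (J.dR 1)))
        - u ^ 2 * (lapse m R / 2 * (2 * inner ℝ (J.val 2) (J.dR 2)) - m * ‖J.val 2‖ ^ 2))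
      + -(c * ((2 * morawetzG m u R / k) • (conj (J.val 0) * J.val 1)
            + (u ^ 2 * k) • (conj (J.val 1) * J.val 2)).re
        + s * ((2 * morawetzG m u R / k) • (conj (J.dθ 0) * J.val 1 + conj (J.val 0) * J.dθ 1)
            + (u ^ 2 * k) • (conj (J.dθ 1) * J.val 2 + conj (J.val 1) * J.dθ 2)).re)
      + ((2 * morawetzG m u R / k) • (conj (J.dφ 0) * J.val 1 + conj (J.val 0) * J.dφ 1)
            + (u ^ 2 * k) • (conj (J.dφ 1) * J.val 2 + conj (J.val 1) * J.dφ 2)).im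
      = s * (4 * m * R ^ 2 / lapse m R * (3 + u * R) * ‖J.val 0‖ ^ 2) := by
  have e1 := congrArg (fun z => (conj (J.val 0) * z).re) hJ.eq1
  have e2 := congrArg (fun z => (conj (J.val 1) * z).re) hJ.eq2
  have e3 := congrArg (fun z => (conj (J.val 1) * z).re) hJ.eq3
  have e4 := congrArg (fun z => (conj (J.val 2) * z).re) hJ.eq4
  have hm : m = (1 - k ^ 2) / (2 * R) := by
    rw [← hkF, lapse]
    field_simp
    ring
  simp only [Complex.inner, ← Complex.normSq_eq_norm_sq, Complex.normSq_apply]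
  simp only [pow_two, Complex.conj_re, Complex.conj_im, Complex.add_re, Complex.add_im,
    Complex.sub_re, Complex.sub_im, Complex.mul_re, Complex.mul_im, Complex.smul_re,
    Complex.smul_im, smul_eq_mul, Complex.ofReal_re, Complex.ofReal_im, Complex.I_re,
    Complex.I_im, Complex.zero_re, Complex.zero_im, Complex.div_ofNat_re, Complex.div_ofNat_im,
    Complex.re_ofNat, Complex.im_ofNat] at e1 e2 e3 e4 ⊢
  linear_combination (norm := skip) 4 * morawetzG m u R / k ^ 2 * e1
    - 2 * morawetzG m u R / k * e2 + 2 * u ^ 2 * e3 - u ^ 2 * e4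
  clear e1 e2 e3 e4 hJ
  simp only [morawetzG, pow_two, hkF]
  rw [hm]
  field_simp
  ring

theorem divergence_currentDensity (hB : IsMaxwellField m u₀ B)
    (hx : (x.1, x.2.1) ∈ domainInterior m u₀) (hθ : x.2.2.1 ∈ Ioo 0 Real.pi) :
    divergence (currentDensity m B) x = Real.sin x.2.2.1 *
      (4 * m * x.2.1 ^ 2 / lapse m x.2.1 * (3 + x.1 * x.2.1) * ‖component m B 0 x‖ ^ 2) := by
  have hF : 0 < lapse m x.2.1 := lapse_pos_of_mem_domain (domainInterior_subset_domain m u₀ hx)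
  have hAθ := hasDerivAt_smul_conj_mul_add (hasDerivAt_component_theta hB hx)
    (a := 2 * morawetzG m x.1 x.2.1 / √(lapse m x.2.1)) (b := x.1 ^ 2 * √(lapse m x.2.1))
  have hAφ := hasDerivAt_smul_conj_mul_add (hasDerivAt_component_phi hB hx)
    (a := 2 * morawetzG m x.1 x.2.1 / √(lapse m x.2.1)) (b := x.1 ^ 2 * √(lapse m x.2.1))
  rw [divergence_eq_of_hasDerivAt (differentiableAt_currentDensity hB hx)
    ((hasDerivAt_fluxU hB hx).const_mul (Real.sin x.2.2.1))
    ((hasDerivAt_fluxR hB hx).const_mul (Real.sin x.2.2.1))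
    ((Real.hasDerivAt_sin _).mul (Complex.reCLM.hasFDerivAt.comp_hasDerivAt _ hAθ)).neg
    (Complex.imCLM.hasFDerivAt.comp_hasDerivAt _ hAφ)]
  exact (isMaxwell_jet hB hx hθ).divergence_eq hx.2.1.ne' (Real.sqrt_pos.2 hF).ne'
    (Real.sq_sqrt hF.le).symm x.1

theorem morawetzL_eq (m u R : ℝ) : morawetzL m u R = √(2 / lapse m R) * morawetzG m u R := by
  rw [morawetzL, morawetzG]
  ring

theorem sqrt_two_div_mul_sqrt_half {a : ℝ} (ha : 0 < a) : √(2 / a) * √(a / 2) = 1 := by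
  rw [← Real.sqrt_mul (div_pos two_pos ha).le, div_mul_div_cancel₀ ha.ne', div_self two_ne_zero,
    Real.sqrt_one]

theorem currentU_eq_fluxU (hx : 0 < lapse m x.2.1) (B : BilinField) :
    currentU m B x.1 x.2.1 x.2.2.1 x.2.2.2 = fluxU m B x := by
  have h1 := Real.mul_self_sqrt (div_pos two_pos hx).le
  have h2 := sqrt_two_div_mul_sqrt_half hx
  change _ * (_ * ‖component m B 0 x‖ ^ 2 + _ * ‖component m B 1 x‖ ^ 2) = _
  rw [morawetzL_eq, morawetzN, fluxU]
  linear_combination (morawetzG m x.1 x.2.1 * ‖component m B 0 x‖ ^ 2) * h1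
    + (x.1 ^ 2 * ‖component m B 1 x‖ ^ 2) * h2

theorem currentR_eq_fluxR (hx : 0 < lapse m x.2.1) (B : BilinField) :
    currentR m B x.1 x.2.1 x.2.2.1 x.2.2.2 = fluxR m B x := by
  have h2 := sqrt_two_div_mul_sqrt_half hx
  have h3 := Real.mul_self_sqrt (half_pos hx).le
  have hG : lapse m x.2.1 * (2 / lapse m x.2.1) = 2 := mul_div_cancel₀ 2 hx.ne'
  rw [currentR, mul_right_comm, ← currentU, currentU_eq_fluxU hx]
  change -_ * (_ * ‖component m B 1 x‖ ^ 2 + _ * ‖component m B 2 x‖ ^ 2) + _ = _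
  rw [morawetzL_eq, morawetzN, fluxU, fluxR]
  unfold morawetzG
  linear_combination (-(2 + 2 * (x.1 * x.2.1) + (x.1 * x.2.1) ^ 2 * lapse m x.2.1 / 2)
      * ‖component m B 1 x‖ ^ 2) * h2 - (x.1 ^ 2 * ‖component m B 2 x‖ ^ 2) * h3
    + (x.2.1 ^ 2 / 2 * (2 + 2 * (x.1 * x.2.1) + (x.1 * x.2.1) ^ 2 * lapse m x.2.1 / 2)
      * ‖component m B 0 x‖ ^ 2) * hG

end Current

section Signs

variable {m u R σ : ℝ} {B : BilinField} {p : ℝ → ℝ} {x : Coords} {y : ℝ × ℝ × ℝ}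

theorem InFarZone.lapse_ge (h : InFarZone m u R) : 3 / 4 ≤ lapse m R := by
  have := h.mass_le
  rw [lapse]
  linarith

theorem InFarZone.lapse_pos (h : InFarZone m u R) : 0 < lapse m R := by
  linarith [h.lapse_ge]

theorem InFarZone.mul_nonpos (h : InFarZone m u R) : u * R ≤ 0 :=
  mul_nonpos_of_nonpos_of_nonneg h.neg.le h.nonneg

theorem InFarZone.morawetzG_ge (h : InFarZone m u R) : 1 / 16 ≤ morawetzG m u R := by
  have hle := h.mul_ge
  have hF := mul_le_mul_of_nonneg_left h.lapse_ge (sq_nonneg (u * R))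
  rw [morawetzG]
  nlinarith

theorem InFarZone.morawetzG_pos (h : InFarZone m u R) : 0 < morawetzG m u R := by
  linarith [h.morawetzG_ge]

theorem InFarZone.fluxU_nonneg (h : InFarZone m x.1 x.2.1) (B : BilinField) :
    0 ≤ fluxU m B x := by
  have hF := h.lapse_pos
  have hG := h.morawetzG_pos
  rw [fluxU]
  positivity

theorem currentDensity_eq_zero (h : ∀ j, component m B j x = 0) : currentDensity m B x = 0 := by
  simp [currentDensity, fluxU, fluxR, fluxAngular, h]

theorem graphFlux_currentDensity (hp : IsRay m σ p) (hF : lapse m (p y.1) ≠ 0) (B : BilinField) :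
    graphFlux (currentDensity m B) p y = Real.sin y.2.1 *
      ((2 * σ - 1) * p y.1 ^ 2 * morawetzG m y.1 (p y.1) * ‖component m B 0 (y.1, p y.1, y.2)‖ ^ 2
        + ((σ - 1 / 2) * (y.1 * p y.1) ^ 2 * lapse m (p y.1) + morawetzG m y.1 (p y.1))
          * ‖component m B 1 (y.1, p y.1, y.2)‖ ^ 2
        + y.1 ^ 2 * lapse m (p y.1) / 2 * ‖component m B 2 (y.1, p y.1, y.2)‖ ^ 2) := by
  rw [graphFlux, hp.deriv_eq, currentDensity, fluxU, fluxR]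
  dsimp only
  field_simp
  rw [morawetzG]
  ring

theorem graphFlux_currentDensity_nonneg (hp : IsRay m σ p) (hσ : 1 / 2 ≤ σ)
    (h : InFarZone m y.1 (p y.1)) (hθ : 0 ≤ Real.sin y.2.1) (B : BilinField) :
    0 ≤ graphFlux (currentDensity m B) p y := by
  have hF := h.lapse_pos
  have hG := h.morawetzG_pos
  have hσ₁ : 0 ≤ 2 * σ - 1 := by linarith
  have : 0 ≤ σ - 1 / 2 := by linarith
  rw [graphFlux_currentDensity hp hF.ne']
  positivity

theorem component_eq_zero_of_graphFlux_eq_zero (hp : IsRay m σ p) (hσ : 1 / 2 < σ)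
    (h : InFarZone m y.1 (p y.1)) (hR : p y.1 ≠ 0) (hθ : 0 < Real.sin y.2.1)
    (hz : graphFlux (currentDensity m B) p y = 0) (j : Fin 3) :
    component m B j (y.1, p y.1, y.2) = 0 := by
  have hF := h.lapse_pos
  have hG := h.morawetzG_pos
  have hu := h.neg.ne
  have hσ₁ : 0 < 2 * σ - 1 := by linarith
  have hσ₂ : 0 < σ - 1 / 2 := by linarith
  have c₀ : 0 < (2 * σ - 1) * p y.1 ^ 2 * morawetzG m y.1 (p y.1) := by positivity
  have c₁ : 0 < (σ - 1 / 2) * (y.1 * p y.1) ^ 2 * lapse m (p y.1) + morawetzG m y.1 (p y.1) := by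
    positivity
  have c₂ : 0 < y.1 ^ 2 * lapse m (p y.1) / 2 := by positivity
  rw [graphFlux_currentDensity hp hF.ne', mul_eq_zero, or_iff_right hθ.ne',
    add_eq_zero_iff_of_nonneg (by positivity) (by positivity),
    add_eq_zero_iff_of_nonneg (by positivity) (by positivity)] at hz
  simp only [mul_eq_zero, c₀.ne', c₁.ne', c₂.ne', false_or, pow_eq_zero_iff two_ne_zero,
    norm_eq_zero] at hz
  fin_cases j
  exacts [hz.1.1, hz.1.2, hz.2]

theorem lapse_hypR_pos (hm : 0 < m) (s u : ℝ) : 0 < lapse m (hypR m s u) := by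
  rw [lapse, hypR]
  split_ifs with hs
  · norm_num
  · rw [mul_one_div, sub_pos, div_lt_one (radius_pos hm _)]
    exact lt_radius hm _

theorem densityH_eq_graphFlux (hm : 0 < m) (s : ℝ) (B : BilinField) :
    densityH m s B = graphFlux (currentDensity m B) (hypR m s) := by
  ext y
  have hF := lapse_hypR_pos hm s y.1
  rw [densityH, graphFlux, (isRay_hypR hm s).deriv_eq,
    currentU_eq_fluxU (x := (y.1, hypR m s y.1, y.2)) hF,
    currentR_eq_fluxR (x := (y.1, hypR m s y.1, y.2)) hF, currentDensity, hypSlope]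
  rcases eq_or_ne s 0 with rfl | hs
  · simp only [hypR_zero, Pi.zero_apply, ↓reduceIte]
    ring
  · simp only [hs, ↓reduceIte]
    ring

theorem densityS_eq_currentDensity (hF : 0 < lapse m y.1) (u : ℝ) (B : BilinField) :
    densityS m u B y = (currentDensity m B (u, y)).1 := by
  rw [densityS, currentU_eq_fluxU (x := (u, y)) hF, mul_comm, currentDensity]

end Signs

section WeightedCurrent

variable {m u₀ κ : ℝ} {B : BilinField} {x : Coords}

/-- The Morawetz current density with the weight `exp (κ / u)`, whose derivative is used to absorb
the divergence of the Morawetz current. -/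
def weightedCurrent (κ m : ℝ) (B : BilinField) (x : Coords) : Coords :=
  Real.exp (κ / x.1) • currentDensity m B x

/-- The divergence of `weightedCurrent κ m B`, for a Maxwell field, in terms of the components of
the field. -/
def weightedSource (κ m : ℝ) (B : BilinField) (x : Coords) : ℝ :=
  Real.exp (κ / x.1) * (Real.sin x.2.2.1 *
    (4 * m * x.2.1 ^ 2 / lapse m x.2.1 * (3 + x.1 * x.2.1) * ‖component m B 0 x‖ ^ 2
      - κ / x.1 ^ 2 * fluxU m B x))

theorem hasDerivAt_exp_div (κ : ℝ) {u : ℝ} (hu : u ≠ 0) :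
    HasDerivAt (fun u => Real.exp (κ / u)) (-(κ / u ^ 2) * Real.exp (κ / u)) u :=
  ((hasDerivAt_const u κ).fun_div (hasDerivAt_id' u) hu).exp.congr_deriv (by ring)

theorem graphFlux_weightedCurrent (κ m : ℝ) (B : BilinField) (p : ℝ → ℝ) (y : ℝ × ℝ × ℝ) :
    graphFlux (weightedCurrent κ m B) p y =
      Real.exp (κ / y.1) * graphFlux (currentDensity m B) p y := by
  simp only [graphFlux, weightedCurrent, Prod.smul_fst, Prod.smul_snd, smul_eq_mul]
  ring

theorem divergence_weightedCurrent (hB : IsMaxwellField m u₀ B)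
    (hx : (x.1, x.2.1) ∈ domainInterior m u₀) (hθ : x.2.2.1 ∈ Ioo 0 Real.pi) (hu : x.1 ≠ 0) :
    divergence (weightedCurrent κ m B) x = weightedSource κ m B x := by
  unfold weightedCurrent
  rw [divergence_smul (w := fun u => Real.exp (κ / u)) (hasDerivAt_exp_div κ hu)
    (differentiableAt_currentDensity hB hx), divergence_currentDensity hB hx hθ, weightedSource,
    currentDensity]
  ring

theorem differentiableAt_weightedCurrent (hB : IsMaxwellField m u₀ B)
    (hx : (x.1, x.2.1) ∈ domainInterior m u₀) (hu : x.1 ≠ 0) :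
    DifferentiableAt ℝ (weightedCurrent κ m B) x :=
  ((hasDerivAt_exp_div κ hu).differentiableAt.comp x differentiableAt_fst).smul
    (differentiableAt_currentDensity hB hx)

theorem continuousOn_exp_div_fst (hu₀ : u₀ < 0) :
    ContinuousOn (fun x : Coords => Real.exp (κ / x.1)) (fieldDomain m u₀) :=
  (continuousOn_const.div continuousOn_fst fun _ hx => (hx.1.trans_lt hu₀).ne).rexp

theorem continuousOn_weightedCurrent (hB : IsMaxwellField m u₀ B) (hu₀ : u₀ < 0) :
    ContinuousOn (weightedCurrent κ m B) (fieldDomain m u₀) :=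
  (continuousOn_exp_div_fst hu₀).smul (contDiffOn_currentDensity hB).continuousOn

theorem continuousOn_weightedSource (hB : IsMaxwellField m u₀ B) (hu₀ : u₀ < 0) :
    ContinuousOn (weightedSource κ m B) (fieldDomain m u₀) := by
  have hφ (j : Fin 3) := (contDiffOn_component hB j).continuousOn
  have hF := (contDiff_lapse (m := m)).continuous.continuousOn (s := fieldDomain m u₀)
  have hG := (contDiff_morawetzG (m := m)).continuous.continuousOn (s := fieldDomain m u₀)
  have hF0 (x) (hx : x ∈ fieldDomain m u₀) : lapse m x.2.1 ≠ 0 := (lapse_pos_of_mem_domain hx).ne'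
  have hu (x) (hx : x ∈ fieldDomain m u₀) : x.1 ^ 2 ≠ 0 := pow_ne_zero 2 (hx.1.trans_lt hu₀).ne
  have hE := continuousOn_exp_div_fst (m := m) (κ := κ) hu₀
  unfold weightedSource fluxU
  fun_prop (disch := assumption)

theorem hasBalancedSides_weightedCurrent (κ m : ℝ) (B : BilinField) :
    HasBalancedSides (weightedCurrent κ m B) (0, 0) (Real.pi, 2 * Real.pi) :=
  (hasBalancedSides_currentDensity m B).smul fun u => Real.exp (κ / u)

theorem weightedSource_zero_nonneg (hm : 0 ≤ m) (h : InFarZone m x.1 x.2.1)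
    (hθ : 0 ≤ Real.sin x.2.2.1) (B : BilinField) : 0 ≤ weightedSource 0 m B x := by
  have hF := h.lapse_pos
  have huR : 0 ≤ 3 + x.1 * x.2.1 := by linarith [h.mul_ge]
  simp only [weightedSource, zero_div, zero_mul, sub_zero]
  positivity

theorem weightedSource_nonpos (hm : 0 ≤ m) (h : InFarZone m x.1 x.2.1)
    (hθ : 0 ≤ Real.sin x.2.2.1) (B : BilinField) : weightedSource (160 * m) m B x ≤ 0 := by
  have hF := h.lapse_pos
  have hu := h.neg.ne
  have key : weightedSource (160 * m) m B x =
      -(Real.sin x.2.2.1 * Real.exp (160 * m / x.1) *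
        (4 * m / (lapse m x.2.1 * x.1 ^ 2)
            * (80 * morawetzG m x.1 x.2.1 - (x.1 * x.2.1) ^ 2 * (3 + x.1 * x.2.1))
            * ‖component m B 0 x‖ ^ 2
          + 160 * m * ‖component m B 1 x‖ ^ 2)) := by
    rw [weightedSource, fluxU]
    field_simp
    ring
  have hq : (x.1 * x.2.1) ^ 2 * (3 + x.1 * x.2.1) ≤ 80 * morawetzG m x.1 x.2.1 := by
    have hge := h.mul_ge
    have hle := h.mul_nonpos
    have hsq : (x.1 * x.2.1) ^ 2 ≤ 25 / 16 := by nlinarith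
    nlinarith [h.morawetzG_ge, sq_nonneg (x.1 * x.2.1)]
  have := sub_nonneg.2 hq
  rw [key, neg_nonpos]
  positivity

end WeightedCurrent

theorem isOpen_angles : IsOpen angles := isOpen_Ioo.prod isOpen_Ioo

theorem angles_subset_Icc : angles ⊆ Icc (0, 0) (Real.pi, 2 * Real.pi) := by
  rw [Icc_prod_eq (0, 0)]
  exact prod_mono Ioo_subset_Icc_self Ioo_subset_Icc_self

theorem isOpen_Ioo_prod_angles (a b : ℝ) : IsOpen (Ioo a b ×ˢ angles) :=
  isOpen_Ioo.prod isOpen_angles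

theorem sin_pos_of_mem_angles {ξ : ℝ × ℝ} (hξ : ξ ∈ angles) : 0 < Real.sin ξ.1 :=
  Real.sin_pos_of_mem_Ioo hξ.1

section EnergyInequalities

variable {m u₀ κ σ α β : ℝ} {B : BilinField} {p : ℝ → ℝ} {X : Coords → Coords}

theorem IsFar.neg (hfar : IsFar m u₀) (hm : 0 < m) : u₀ < 0 :=
  (hfar u₀ le_rfl _ ⟨(isRay_hypR hm 1).nonneg u₀, le_rfl⟩).neg

theorem IsRay.continuous (hp : IsRay m σ p) : Continuous p := hp.contDiff_two.continuous

theorem closedGraphRegion_subset_fieldDomain (hm : 0 < m) (hp : IsRay m σ p) (hβ : β ≤ u₀)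
    (T : Set (ℝ × ℝ)) : closedGraphRegion p (hypR m 1) α β T ⊆ fieldDomain m u₀ :=
  fun _ hx => mem_domain hm (hx.1.2.trans hβ) ⟨(hp.nonneg _).trans hx.2.1.1, hx.2.1.2⟩

theorem mem_domainInterior_of_mem_graphRegion (hm : 0 < m) (hp : IsRay m σ p) (hβ : β ≤ u₀)
    {T : Set (ℝ × ℝ)} {x : Coords} (hx : x ∈ graphRegion p (hypR m 1) α β T) :
    (x.1, x.2.1) ∈ domainInterior m u₀ :=
  mem_domainInterior hm (hx.1.2.trans_le hβ) ⟨(hp.nonneg _).trans_lt hx.2.1.1, hx.2.1.2⟩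

theorem IsFar.inFarZone_of_mem_graphRegion (hfar : IsFar m u₀) (hp : IsRay m σ p) (hβ : β ≤ u₀)
    {T : Set (ℝ × ℝ)} {x : Coords} (hx : x ∈ graphRegion p (hypR m 1) α β T) :
    InFarZone m x.1 x.2.1 :=
  hfar _ (hx.1.2.le.trans hβ) _ ⟨(hp.nonneg _).trans hx.2.1.1.le, hx.2.1.2.le⟩

theorem setIntegral_weightedSource (hm : 0 < m) (hB : IsMaxwellField m u₀ B) (hu₀ : u₀ < 0)
    (hαβ : α < β) (hβ : β ≤ u₀) (hp : IsRay m σ p) (hlt : ∀ u ∈ Ioo α β, p u < hypR m 1 u) :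
    ∫ x in graphRegion p (hypR m 1) α β angles, weightedSource κ m B x =
      (∫ y in Ioo (p β) (hypR m 1 β) ×ˢ angles, (weightedCurrent κ m B (β, y)).1)
        - (∫ y in Ioo (p α) (hypR m 1 α) ×ˢ angles, (weightedCurrent κ m B (α, y)).1)
        + ((∫ y in Ioo α β ×ˢ angles, graphFlux (weightedCurrent κ m B) p y)
        - ∫ y in Ioo α β ×ˢ angles, graphFlux (weightedCurrent κ m B) (hypR m 1) y) := by
  have hq := (isRay_hypR hm 1).contDiff_two
  have hp2 := hp.contDiff_two
  have hdp := hp2.differentiable two_ne_zero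
  have hdq := hq.differentiable two_ne_zero
  have hne (x : Coords) (hx : x ∈ graphRegion p (hypR m 1) α β angles) : x.1 ≠ 0 :=
    ((hx.1.2.trans_le hβ).trans hu₀).ne
  have hdiv : EqOn (divergence (weightedCurrent κ m B)) (weightedSource κ m B)
      (graphRegion p (hypR m 1) α β angles) := fun x hx =>
    divergence_weightedCurrent hB (mem_domainInterior_of_mem_graphRegion hm hp hβ hx) hx.2.2.1
      (hne x hx)
  have hmeas := (isOpen_graphRegion (α := α) (β := β) hp.continuous (isRay_hypR hm 1).continuous
    isOpen_angles).measurableSet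
  have hint := integrableOn_graphRegion_of_continuousOn hdp hdq hαβ hlt
    isOpen_angles.measurableSet isCompact_Icc angles_subset_Icc
    ((continuousOn_weightedSource (κ := κ) hB hu₀).mono
      (closedGraphRegion_subset_fieldDomain hm hp hβ _))
  rw [← setIntegral_congr_fun hmeas hdiv]
  exact setIntegral_divergence_graphRegion hp2 hq hαβ hlt
    ⟨Real.pi_pos.le, Real.two_pi_pos.le⟩ rfl
    ((continuousOn_weightedCurrent hB hu₀).mono (closedGraphRegion_subset_fieldDomain hm hp hβ _))
    (fun x hx => differentiableAt_weightedCurrent hB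
      (mem_domainInterior_of_mem_graphRegion hm hp hβ hx) (hne x hx))
    (hint.congr_fun hdiv.symm hmeas) (hasBalancedSides_weightedCurrent κ m B)

theorem continuousOn_graphFlux (hm : 0 < m) (hX : ContinuousOn X (fieldDomain m u₀))
    (hp : IsRay m σ p) (hβ : β ≤ u₀) (hle : ∀ u ∈ Icc α β, p u ≤ hypR m 1 u) :
    ContinuousOn (graphFlux X p) (Icc α β ×ˢ univ) := by
  have hp' := hp.contDiff_two.continuous_deriv one_le_two
  have hp0 := hp.continuous
  have hXp : ContinuousOn (fun y : ℝ × ℝ × ℝ => X (y.1, p y.1, y.2)) (Icc α β ×ˢ univ) :=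
    hX.comp (by fun_prop) fun y hy =>
      mem_domain hm (hy.1.2.trans hβ) ⟨hp.nonneg _, hle _ hy.1⟩
  exact ((hp'.comp continuous_fst).continuousOn.mul hXp.fst).sub hXp.snd.fst

theorem integrableOn_graphFlux (hm : 0 < m) (hX : ContinuousOn X (fieldDomain m u₀))
    (hp : IsRay m σ p) (hβ : β ≤ u₀) (hle : ∀ u ∈ Icc α β, p u ≤ hypR m 1 u) :
    IntegrableOn (graphFlux X p) (Ioo α β ×ˢ angles) :=
  (((continuousOn_graphFlux hm hX hp hβ hle).mono
    (prod_mono subset_rfl (subset_univ _))).integrableOn_compact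
      (isCompact_Icc.prod isCompact_Icc)).mono_set (prod_mono Ioo_subset_Icc_self angles_subset_Icc)

theorem IsFar.graphFlux_nonneg (hfar : IsFar m u₀) (hβ : β ≤ u₀) (hp : IsRay m σ p)
    (hσ : 1 / 2 ≤ σ) (hle : ∀ u ∈ Ioo α β, p u ≤ hypR m 1 u) (B : BilinField)
    {y : ℝ × ℝ × ℝ} (hy : y ∈ Ioo α β ×ˢ angles) : 0 ≤ graphFlux (currentDensity m B) p y :=
  graphFlux_currentDensity_nonneg hp hσ
    (hfar _ (hy.1.2.le.trans hβ) _ ⟨hp.nonneg _, hle _ hy.1⟩) (sin_pos_of_mem_angles hy.2).le B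

theorem IsFar.currentDensity_fst_nonneg (hfar : IsFar m u₀) (hβ : β ≤ u₀) (hp : IsRay m σ p)
    (B : BilinField) {y : ℝ × ℝ × ℝ} (hy : y ∈ Ioo (p β) (hypR m 1 β) ×ˢ angles) :
    0 ≤ (currentDensity m B (β, y)).1 :=
  mul_nonneg (sin_pos_of_mem_angles hy.2).le
    ((hfar β hβ y.1 ⟨(hp.nonneg _).trans hy.1.1.le, hy.1.2.le⟩).fluxU_nonneg (x := (β, y)) B)

theorem setIntegral_graphFlux_hypR_one_le (hm : 0 < m) (hfar : IsFar m u₀)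
    (hB : IsMaxwellField m u₀ B) (hαβ : α < β) (hβ : β ≤ u₀) (hp : IsRay m σ p)
    (hlt : ∀ u ∈ Ioo α β, p u < hypR m 1 u)
    (hα : ∀ y ∈ Ioo (p α) (hypR m 1 α) ×ˢ angles, (currentDensity m B (α, y)).1 = 0) :
    ∫ y in Ioo α β ×ˢ angles, graphFlux (currentDensity m B) (hypR m 1) y ≤
      (∫ y in Ioo α β ×ˢ angles, graphFlux (currentDensity m B) p y)
        + ∫ y in Ioo (p β) (hypR m 1 β) ×ˢ angles, (currentDensity m B (β, y)).1 := by
  have hJ : weightedCurrent 0 m B = currentDensity m B := by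
    ext1 x
    simp [weightedCurrent]
  have key := setIntegral_weightedSource (κ := 0) hm hB (hfar.neg hm) hαβ hβ hp hlt
  rw [hJ, setIntegral_eq_zero_of_forall_eq_zero hα] at key
  have hsource : 0 ≤ ∫ x in graphRegion p (hypR m 1) α β angles, weightedSource 0 m B x :=
    setIntegral_nonneg (isOpen_graphRegion hp.continuous (isRay_hypR hm 1).continuous
      isOpen_angles).measurableSet fun x hx => weightedSource_zero_nonneg hm.le
        (hfar.inFarZone_of_mem_graphRegion hp hβ hx) (sin_pos_of_mem_angles hx.2.2).le B
  linarith

theorem setIntegral_graphFlux_weightedCurrent_le (hm : 0 < m) (hfar : IsFar m u₀)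
    (hB : IsMaxwellField m u₀ B) (hαβ : α < β) (hβ : β ≤ u₀) (hp : IsRay m σ p)
    (hlt : ∀ u ∈ Ioo α β, p u < hypR m 1 u)
    (hα : ∀ y ∈ Ioo (p α) (hypR m 1 α) ×ˢ angles, (currentDensity m B (α, y)).1 = 0) :
    ∫ y in Ioo α β ×ˢ angles, graphFlux (weightedCurrent (160 * m) m B) p y ≤
      ∫ y in Ioo α β ×ˢ angles, graphFlux (weightedCurrent (160 * m) m B) (hypR m 1) y := by
  have key := setIntegral_weightedSource (κ := 160 * m) hm hB (hfar.neg hm) hαβ hβ hp hlt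
  have hstart : ∫ y in Ioo (p α) (hypR m 1 α) ×ˢ angles,
      (weightedCurrent (160 * m) m B (α, y)).1 = 0 :=
    setIntegral_eq_zero_of_forall_eq_zero fun y hy => mul_eq_zero_of_right _ (hα y hy)
  have hsource : ∫ x in graphRegion p (hypR m 1) α β angles, weightedSource (160 * m) m B x ≤ 0 :=
    setIntegral_nonpos (isOpen_graphRegion hp.continuous (isRay_hypR hm 1).continuous
      isOpen_angles).measurableSet fun x hx => weightedSource_nonpos hm.le
        (hfar.inFarZone_of_mem_graphRegion hp hβ hx) (sin_pos_of_mem_angles hx.2.2).le B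
  have hend : 0 ≤ ∫ y in Ioo (p β) (hypR m 1 β) ×ˢ angles,
      (weightedCurrent (160 * m) m B (β, y)).1 :=
    setIntegral_nonneg (isOpen_Ioo_prod_angles _ _).measurableSet fun y hy =>
      mul_nonneg (Real.exp_pos _).le (hfar.currentDensity_fst_nonneg hβ hp B hy)
  linarith

theorem setIntegral_graphFlux_le (hm : 0 < m) (hfar : IsFar m u₀) (hB : IsMaxwellField m u₀ B)
    (hαβ : α < β) (hβ : β ≤ u₀) (hp : IsRay m σ p) (hσ : 1 / 2 ≤ σ)
    (hlt : ∀ u ∈ Ioo α β, p u < hypR m 1 u)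
    (hα : ∀ y ∈ Ioo (p α) (hypR m 1 α) ×ˢ angles, (currentDensity m B (α, y)).1 = 0) :
    ∫ y in Ioo α β ×ˢ angles, graphFlux (currentDensity m B) p y ≤
      Real.exp (-(160 * m / β)) *
        ∫ y in Ioo α β ×ˢ angles, graphFlux (currentDensity m B) (hypR m 1) y := by
  have hq := isRay_hypR hm 1
  have hle (u : ℝ) (hu : u ∈ Icc α β) : p u ≤ hypR m 1 u :=
    le_on_Icc_of_lt_on_Ioo hp.continuous hq.continuous hαβ hlt hu
  have hβ0 : β < 0 := hβ.trans_lt (hfar.neg hm)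
  have hJ := (contDiffOn_currentDensity hB).continuousOn
  have hW := continuousOn_weightedCurrent (κ := 160 * m) hB (hfar.neg hm)
  have hmeas := (isOpen_Ioo_prod_angles α β).measurableSet
  have hlow : ∫ y in Ioo α β ×ˢ angles,
      Real.exp (160 * m / β) * graphFlux (currentDensity m B) p y ≤
        ∫ y in Ioo α β ×ˢ angles, graphFlux (weightedCurrent (160 * m) m B) p y := by
    refine setIntegral_mono_on ((integrableOn_graphFlux hm hJ hp hβ hle).const_mul _)
      (integrableOn_graphFlux hm hW hp hβ hle) hmeas fun y hy => ?_
    rw [graphFlux_weightedCurrent]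
    refine mul_le_mul_of_nonneg_right (Real.exp_le_exp.2 ?_)
      (hfar.graphFlux_nonneg hβ hp hσ (fun u hu => (hlt u hu).le) B hy)
    rw [div_eq_mul_one_div, div_eq_mul_one_div (160 * m) y.1]
    exact mul_le_mul_of_nonneg_left (one_div_le_one_div_of_neg_of_le hβ0 hy.1.2.le) (by positivity)
  have hupp : ∫ y in Ioo α β ×ˢ angles, graphFlux (weightedCurrent (160 * m) m B) (hypR m 1) y ≤
      ∫ y in Ioo α β ×ˢ angles, graphFlux (currentDensity m B) (hypR m 1) y := by
    refine setIntegral_mono_on (integrableOn_graphFlux hm hW hq hβ fun _ _ => le_rfl)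
      (integrableOn_graphFlux hm hJ hq hβ fun _ _ => le_rfl) hmeas fun y hy => ?_
    rw [graphFlux_weightedCurrent]
    refine mul_le_of_le_one_left
      (hfar.graphFlux_nonneg hβ hq (by norm_num [hypSlope]) (fun _ _ => le_rfl) B hy) ?_
    exact Real.exp_le_one_iff.2
      (div_nonpos_of_nonneg_of_nonpos (by positivity) (hy.1.2.trans hβ0).le)
  rw [integral_const_mul] at hlow
  rw [Real.exp_neg, inv_mul_eq_div, le_div_iff₀' (Real.exp_pos _)]
  exact hlow.trans
    ((setIntegral_graphFlux_weightedCurrent_le hm hfar hB hαβ hβ hp hlt hα).trans hupp)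

end EnergyInequalities

theorem eqOn_zero_of_setIntegral_nonpos {E : Type*} [TopologicalSpace E] [MeasurableSpace E]
    [OpensMeasurableSpace E] {μ : Measure E} [μ.IsOpenPosMeasure] {f : E → ℝ} {U : Set E}
    (hU : IsOpen U) (hc : ContinuousOn f U) (hint : IntegrableOn f U μ) (hf : ∀ x ∈ U, 0 ≤ f x)
    (h : ∫ x in U, f x ∂μ ≤ 0) : EqOn f 0 U := by
  have hae : 0 ≤ᵐ[μ.restrict U] f := ae_restrict_of_forall_mem hU.measurableSet hf
  have h0 := h.antisymm (setIntegral_nonneg hU.measurableSet hf)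
  exact Measure.eqOn_open_of_ae_eq ((setIntegral_eq_zero_iff_of_nonneg_ae hae hint).1 h0) hU hc
    continuousOn_const

section FiniteSpeed

variable {m u₀ L σ α β : ℝ} {B : BilinField} {p : ℝ → ℝ}

theorem graphFlux_eqOn_zero (hm : 0 < m) (hfar : IsFar m u₀) (hB : IsMaxwellField m u₀ B)
    (hαβ : α < β) (hβ : β ≤ u₀) (hp : IsRay m σ p) (hσ : 1 / 2 ≤ σ)
    (hlt : ∀ u ∈ Ioo α β, p u < hypR m 1 u)
    (hα : ∀ y ∈ Ioo (p α) (hypR m 1 α) ×ˢ angles, (currentDensity m B (α, y)).1 = 0)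
    (hdata : ∀ y ∈ Ioo α β ×ˢ angles, graphFlux (currentDensity m B) (hypR m 1) y = 0) :
    EqOn (graphFlux (currentDensity m B) p) 0 (Ioo α β ×ˢ angles) := by
  have hflux := setIntegral_graphFlux_le hm hfar hB hαβ hβ hp hσ hlt hα
  rw [setIntegral_eq_zero_of_forall_eq_zero hdata, mul_zero] at hflux
  have hle (u : ℝ) (hu : u ∈ Icc α β) : p u ≤ hypR m 1 u :=
    le_on_Icc_of_lt_on_Ioo hp.continuous (isRay_hypR hm 1).continuous hαβ hlt hu
  have hJ := (contDiffOn_currentDensity hB).continuousOn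
  exact eqOn_zero_of_setIntegral_nonpos (isOpen_Ioo_prod_angles _ _)
    ((continuousOn_graphFlux hm hJ hp hβ hle).mono (prod_mono Ioo_subset_Icc_self (subset_univ _)))
    (integrableOn_graphFlux hm hJ hp hβ hle)
    (fun y hy => hfar.graphFlux_nonneg hβ hp hσ (fun u hu => (hlt u hu).le) B hy) hflux

theorem component_eq_zero_of_lt (hm : 0 < m) (hfar : IsFar m u₀) (hB : IsMaxwellField m u₀ B)
    (hL : L ≤ u₀)
    (hdata : ∀ u < L, ∀ ξ ∈ angles, ∀ j, component m B j (u, hypR m 1 u, ξ) = 0)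
    {u R : ℝ} (hu : u < L) (hR : R ∈ Ioo 0 (hypR m 1 u)) {ξ : ℝ × ℝ} (hξ : ξ ∈ angles)
    (j : Fin 3) : component m B j (u, R, ξ) = 0 := by
  have hmR : 2 * m * R < 1 := lt_of_lt_of_le (by gcongr; exact hR.2) (two_mul_hypR_one_lt hm u).le
  -- A line `r_* = c - (3/4) u` is spacelike, and meets `{t = 0}` where `u = -4 c`; any slope
  -- strictly between `1/2` and `1` would serve.
  obtain ⟨c, rfl⟩ := exists_lineR_eq hm hR.1 hmR (3 / 4) u
  obtain ⟨β, huβ, hβL⟩ := exists_between hu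
  have hp := isRay_lineR hm c (3 / 4)
  have hlt_iff (v : ℝ) : lineR m c (3 / 4) v < hypR m 1 v ↔ -4 * c < v := by
    rw [hypR_one, lineR_lt_lineR_iff hm]
    constructor <;> intro h <;> linarith
  have hαu := (hlt_iff u).1 hR.2
  have hzero := graphFlux_eqOn_zero hm hfar hB (hαu.trans huβ) (hβL.le.trans hL) hp (by norm_num)
    (fun v hv => (hlt_iff v).2 hv.1)
    (fun y hy => absurd ((hlt_iff _).1 (hy.1.1.trans hy.1.2)) (lt_irrefl _))
    (fun y hy => by
      simp [graphFlux, currentDensity_eq_zero (hdata y.1 (hy.1.2.trans hβL) y.2 hy.2)])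
  exact component_eq_zero_of_graphFlux_eq_zero (y := (u, ξ)) hp (by norm_num)
    (hfar u (hu.le.trans hL) _ (Ioo_subset_Icc_self hR)) hR.1.ne' (sin_pos_of_mem_angles hξ)
    (hzero ⟨⟨hαu, huβ⟩, hξ⟩) j

/-- The field vanishes at all points of `{t ≥ 0}` with `u < L`, null infinity included. -/
def VanishesBefore (m L : ℝ) (B : BilinField) : Prop :=
  ∀ u < L, ∀ R ∈ Icc 0 (hypR m 1 u), ∀ ξ ∈ angles, ∀ j, component m B j (u, R, ξ) = 0

theorem exists_vanishesBefore (hm : 0 < m) (hfar : IsFar m u₀) (hB : IsMaxwellField m u₀ B)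
    (hdata : DataSupportedAwayFromI0 m u₀ B) : ∃ L ≤ u₀, VanishesBefore m L B := by
  obtain ⟨L, hL⟩ := hdata
  have hdata' (u : ℝ) (hu : u < min L u₀) (ξ : ℝ × ℝ) (hξ : ξ ∈ angles) (j : Fin 3) :
      component m B j (u, hypR m 1 u, ξ) = 0 := by
    have h := hL u (hu.le.trans (min_le_right _ _)) (hu.trans_le (min_le_left _ _)) ξ.1 hξ.1 ξ.2
    fin_cases j
    exacts [h.1, h.2.1, h.2.2]
  refine ⟨min L u₀, min_le_right _ _, fun u hu R hR ξ hξ j => ?_⟩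
  have hpos : 0 < hypR m 1 u := by
    rw [hypR_one]
    exact lineR_pos hm 0 1 u
  have hcont : ContinuousOn (fun R => component m B j (u, R, ξ)) (Icc 0 (hypR m 1 u)) :=
    (contDiffOn_component hB j).continuousOn.comp (by fun_prop)
      fun R hR => mem_domain hm (hu.le.trans (min_le_right _ _)) hR
  have hopen : EqOn (fun R => component m B j (u, R, ξ)) 0 (Ioo 0 (hypR m 1 u)) := fun R hR =>
    component_eq_zero_of_lt hm hfar hB (min_le_right _ _) hdata' hu hR hξ j
  exact hopen.of_subset_closure hcont continuousOn_const Ioo_subset_Icc_self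
    (closure_Ioo hpos.ne).ge hR

end FiniteSpeed

section Energies

variable {m u₀ L α s : ℝ} {B : BilinField}

theorem VanishesBefore.mono (hL : VanishesBefore m L B) (hα : α ≤ L) : VanishesBefore m α B :=
  fun u hu => hL u (hu.trans_le hα)

theorem hypR_le_hypR_one (hm : 0 < m) (h0 : 0 ≤ s) (h1 : s ≤ 1) {u : ℝ} (hu : u < 0) :
    hypR m s u ≤ hypR m 1 u := by
  rcases h1.eq_or_lt with rfl | h1
  · exact le_rfl
  · exact (hypR_lt_hypR_one hm h0 h1 hu).le

theorem VanishesBefore.densityH_eq_zero (hL : VanishesBefore m L B) (hα : α < L) (hm : 0 < m)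
    (hu₀ : u₀ < 0) (h0 : 0 ≤ s) (h1 : s ≤ 1) {y : ℝ × ℝ × ℝ}
    (hy : y ∈ paramH u₀ \ Ioo α u₀ ×ˢ angles) : densityH m s B y = 0 := by
  obtain ⟨⟨hyu, hξ⟩, hn⟩ := hy
  have hyα : y.1 ≤ α := not_lt.1 fun h => hn ⟨⟨h, hyu⟩, hξ⟩
  rw [densityH_eq_graphFlux hm, graphFlux, currentDensity_eq_zero
    (hL y.1 (hyα.trans_lt hα) _ ⟨(isRay_hypR hm s).nonneg _,
      hypR_le_hypR_one hm h0 h1 (hyu.trans hu₀)⟩ y.2 hξ)]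
  simp

theorem isOpen_paramH (u₀ : ℝ) : IsOpen (paramH u₀) := isOpen_Iio.prod isOpen_angles

theorem integrableOn_densityH (hm : 0 < m) (hu₀ : u₀ < 0) (hB : IsMaxwellField m u₀ B)
    (hL : VanishesBefore m L B) (h0 : 0 ≤ s) (h1 : s ≤ 1) :
    IntegrableOn (densityH m s B) (paramH u₀) := by
  obtain ⟨α, hα⟩ := exists_lt L
  refine IntegrableOn.of_forall_sdiff_eq_zero (s := Ioo α u₀ ×ˢ angles) ?_
    (isOpen_paramH u₀).measurableSet fun y => hL.densityH_eq_zero hα hm hu₀ h0 h1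
  rw [densityH_eq_graphFlux hm]
  exact integrableOn_graphFlux hm (contDiffOn_currentDensity hB).continuousOn (isRay_hypR hm s)
    le_rfl fun u hu => hypR_le_hypR_one hm h0 h1 (hu.2.trans_lt hu₀)

theorem energyH_eq_setIntegral_graphFlux (hm : 0 < m) (hu₀ : u₀ < 0) (hL : VanishesBefore m L B)
    (hα : α < L) (h0 : 0 ≤ s) (h1 : s ≤ 1) :
    energyH m u₀ s B = ∫ y in Ioo α u₀ ×ˢ angles, graphFlux (currentDensity m B) (hypR m s) y := by
  rw [← densityH_eq_graphFlux hm]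
  exact setIntegral_eq_of_subset_of_forall_sdiff_eq_zero (isOpen_paramH u₀).measurableSet
    (prod_mono Ioo_subset_Iio_self subset_rfl) fun y => hL.densityH_eq_zero hα hm hu₀ h0 h1

theorem densityS_eq_of_mem_paramS (hm : 0 < m) {y : ℝ × ℝ × ℝ} (hy : y ∈ paramS m u₀ s) :
    densityS m u₀ B y = (currentDensity m B (u₀, y)).1 :=
  densityS_eq_currentDensity (lapse_pos_of_mem_domain <|
    mem_domain hm le_rfl ⟨((isRay_hypR hm s).nonneg _).trans hy.1.1.le, hy.1.2.le⟩) u₀ B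

theorem integrableOn_densityS (hm : 0 < m) (hB : IsMaxwellField m u₀ B) (s : ℝ) :
    IntegrableOn (densityS m u₀ B) (paramS m u₀ s) := by
  have hmaps : MapsTo (fun y : ℝ × ℝ × ℝ => (u₀, y))
      (Icc (hypR m s u₀) (hypR m 1 u₀) ×ˢ Icc (0, 0) (Real.pi, 2 * Real.pi)) (fieldDomain m u₀) :=
    fun y hy => mem_domain hm le_rfl ⟨((isRay_hypR hm s).nonneg _).trans hy.1.1, hy.1.2⟩
  have hcont := ((contDiffOn_currentDensity hB).continuousOn.comp (by fun_prop) hmaps).fst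
  refine IntegrableOn.congr_fun ((hcont.integrableOn_compact
    (isCompact_Icc.prod isCompact_Icc)).mono_set
      (prod_mono Ioo_subset_Icc_self angles_subset_Icc))
    (fun y hy => (densityS_eq_of_mem_paramS hm hy).symm)
    (isOpen_Ioo_prod_angles _ _).measurableSet

theorem energyS_eq_setIntegral_currentDensity (hm : 0 < m) (u₀ s : ℝ) (B : BilinField) :
    energyS m u₀ s B = ∫ y in Ioo (hypR m s u₀) (hypR m 1 u₀) ×ˢ angles,
      (currentDensity m B (u₀, y)).1 :=
  setIntegral_congr_fun (isOpen_Ioo_prod_angles _ _).measurableSet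
    fun _ hy => densityS_eq_of_mem_paramS hm hy

theorem energyH_nonneg (hm : 0 < m) (hfar : IsFar m u₀) (h0 : 0 ≤ s) (h1 : s ≤ 1)
    (B : BilinField) : 0 ≤ energyH m u₀ s B := by
  refine setIntegral_nonneg (isOpen_paramH u₀).measurableSet fun y hy => ?_
  have hσ := one_le_hypSlope h0 h1
  rw [densityH_eq_graphFlux hm]
  exact graphFlux_currentDensity_nonneg (isRay_hypR hm s) (by linarith)
    (hfar _ (le_of_lt hy.1) _ ⟨(isRay_hypR hm s).nonneg _,
      hypR_le_hypR_one hm h0 h1 (lt_trans hy.1 (hfar.neg hm))⟩) (sin_pos_of_mem_angles hy.2).le B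

theorem energyS_nonneg (hm : 0 < m) (hfar : IsFar m u₀) (s : ℝ) (B : BilinField) :
    0 ≤ energyS m u₀ s B := by
  rw [energyS_eq_setIntegral_currentDensity hm]
  exact setIntegral_nonneg (isOpen_Ioo_prod_angles _ _).measurableSet fun y hy =>
    hfar.currentDensity_fst_nonneg le_rfl (isRay_hypR hm s) B hy

theorem VanishesBefore.currentDensity_fst_eq_zero (hL : VanishesBefore m L B) (hα : α < L)
    (hm : 0 < m) {y : ℝ × ℝ × ℝ} (hy : y ∈ Ioo (hypR m s α) (hypR m 1 α) ×ˢ angles) :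
    (currentDensity m B (α, y)).1 = 0 := by
  rw [currentDensity_eq_zero
    (hL α hα y.1 ⟨((isRay_hypR hm s).nonneg _).trans hy.1.1.le, hy.1.2.le⟩ y.2 hy.2)]
  rfl

theorem energyH_le_exp_mul (hm : 0 < m) (hfar : IsFar m u₀) (hB : IsMaxwellField m u₀ B)
    (hLu : L ≤ u₀) (hL : VanishesBefore m L B) (h0 : 0 ≤ s) (h1 : s < 1) :
    energyH m u₀ s B ≤ Real.exp (-(160 * m / u₀)) * energyH m u₀ 1 B := by
  obtain ⟨α, hα⟩ := exists_lt L
  have hu₀ := hfar.neg hm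
  have hσ := one_le_hypSlope h0 h1.le
  rw [energyH_eq_setIntegral_graphFlux hm hu₀ hL hα h0 h1.le,
    energyH_eq_setIntegral_graphFlux hm hu₀ hL hα zero_le_one le_rfl]
  exact setIntegral_graphFlux_le hm hfar hB (hα.trans_le hLu) le_rfl (isRay_hypR hm s)
    (by linarith) (fun u hu => hypR_lt_hypR_one hm h0 h1 (hu.2.trans hu₀))
    fun y => hL.currentDensity_fst_eq_zero hα hm

theorem energyH_one_le_add (hm : 0 < m) (hfar : IsFar m u₀) (hB : IsMaxwellField m u₀ B)
    (hLu : L ≤ u₀) (hL : VanishesBefore m L B) (h0 : 0 ≤ s) (h1 : s < 1) :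
    energyH m u₀ 1 B ≤ energyH m u₀ s B + energyS m u₀ s B := by
  obtain ⟨α, hα⟩ := exists_lt L
  have hu₀ := hfar.neg hm
  rw [energyH_eq_setIntegral_graphFlux hm hu₀ hL hα h0 h1.le,
    energyH_eq_setIntegral_graphFlux hm hu₀ hL hα zero_le_one le_rfl,
    energyS_eq_setIntegral_currentDensity hm]
  exact setIntegral_graphFlux_hypR_one_le hm hfar hB (hα.trans_le hLu) le_rfl (isRay_hypR hm s)
    (fun u hu => hypR_lt_hypR_one hm h0 h1 (hu.2.trans hu₀))
    fun y => hL.currentDensity_fst_eq_zero hα hm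

end Energies

end

end MaxwellPeeling

theorem proposition1 (m : ℝ) (hm : 0 < m) :
    ∃ U : ℝ, U < 0 ∧ ∀ u₀ : ℝ, u₀ ≤ U →
      ∃ C : ℝ, 0 < C ∧ ∀ B : MaxwellPeeling.BilinField,
        MaxwellPeeling.IsMaxwellField m u₀ B →
        MaxwellPeeling.DataSupportedAwayFromI0 m u₀ B →
        ∀ s : ℝ, 0 ≤ s → s < 1 →
          IntegrableOn (MaxwellPeeling.densityH m s B) (MaxwellPeeling.paramH u₀) ∧
          IntegrableOn (MaxwellPeeling.densityH m 1 B) (MaxwellPeeling.paramH u₀) ∧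
          IntegrableOn (MaxwellPeeling.densityS m u₀ B) (MaxwellPeeling.paramS m u₀ s) ∧
          MaxwellPeeling.energyH m u₀ s B ≤ C * MaxwellPeeling.energyH m u₀ 1 B ∧
          MaxwellPeeling.energyH m u₀ 1 B ≤
            C * (MaxwellPeeling.energyH m u₀ s B + MaxwellPeeling.energyS m u₀ s B) := by
  obtain ⟨U, hU⟩ := Filter.eventually_atBot.1 (MaxwellPeeling.eventually_isFar hm)
  refine ⟨U, (hU U le_rfl).neg hm, fun u₀ hu₀ =>
    ⟨Real.exp (-(160 * m / u₀)), Real.exp_pos _, fun B hB hdata s h0 h1 => ?_⟩⟩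
  have hfar := hU u₀ hu₀
  have hneg := hfar.neg hm
  have hC : 1 ≤ Real.exp (-(160 * m / u₀)) :=
    Real.one_le_exp (neg_nonneg.2 (div_nonpos_of_nonneg_of_nonpos (by positivity) hneg.le))
  obtain ⟨L, hLu, hL⟩ := MaxwellPeeling.exists_vanishesBefore hm hfar hB hdata
  refine ⟨MaxwellPeeling.integrableOn_densityH hm hneg hB hL h0 h1.le,
    MaxwellPeeling.integrableOn_densityH hm hneg hB hL zero_le_one le_rfl,
    MaxwellPeeling.integrableOn_densityS hm hB s,
    MaxwellPeeling.energyH_le_exp_mul hm hfar hB hLu hL h0 h1,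
    (MaxwellPeeling.energyH_one_le_add hm hfar hB hLu hL h0 h1).trans
      (le_mul_of_one_le_left (add_nonneg ?_ ?_) hC)⟩
  · exact MaxwellPeeling.energyH_nonneg hm hfar h0 h1.le B
  · exact MaxwellPeeling.energyS_nonneg hm hfar s B
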